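/- **Setting.** Let $K\ge 1$ and let $(b_t)_{t\ge1}$ and $(\eta_t)_{t\ge1}$ be sequences of real numbers, the learning rates $\eta_t$ being positive and non-increasing. Consider a $K$-armed bandit in which, in each round $t=1,2,\dots$, the environment fixes a (possibly random, possibly history-dependent) loss vector $\ell_t\in[0,b_t]^K$, and the learner then plays an arm $J_t\in\{1,\dots,K\}$ and observes only $\ell_{t,J_t}$. The bounds $b_t$ are deterministic, so $\eta_t$ may be chosen as a function of $b_1,\dots,b_t$. The learner runs Tsallis-INF: with $\tilde C_0=0\in\mathbb R^K$, in round $t$, given the past $\ell_1,J_1,\dots,\ell_{t-1},J_{t-1}$ and the current vector $\ell_t$, the arm $J_t$ is drawn from the distribution $$p_t=\operatorname*{arg\,min}_{p\in\Delta^{K-1}}\Big\{\langle p,\tilde C_{t-1}\rangle-\sum_{i=1}^K\frac{4\sqrt{p_i}-2p_i}{\eta_t}\Big\}$$ ($\Delta^{K-1}$ is the probability simplex), and then $\tilde C_{t,i}=\tilde C_{t-1,i}+\frac{\ell_{t,i}}{p_{t,i}}\mathbf 1\{J_t=i\}$ for all $i$. For $T\ge1$ the pseudo-regret is $$R_T=\mathbb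 E\Big[\sum_{t=1}^T\ell_{t,J_t}\Big]-\min_{i}\mathbb E\Big[\sum_{t=1}^T\ell_{t,i}\Big].$$ **Theorem.** (1) In every such (adversarial) environment, in particular in every oblivious one, $$R_T\le\sqrt K\Big(\sum_{t=1}^T\frac{\eta_t}{2}b_t^2+\frac4{\eta_T}\Big)+1 .$$ (2) Suppose in addition that $b_t>0$ for all $t$ and that the environment is stochastically constrained adversarial with a unique best arm $i^*$: there are constants $\Delta_{i,j}$ such that for all $t,i,j$, almost surely, $$\mathbb E\big[\ell_{t,i}-\ell_{t,j}\,\big|\,\ell_1,J_1,\dots,\ell_{t-1},J_{t-1}\big]=b_t\,\Delta_{i,j},$$ and, with the suboptimality gaps $\Delta_i=\Delta_{i,1}-\min_j\Delta_{j,1}$, the arm $i^*$ is the only arm with $\Delta_{i^*}=0$. Put $\eta_0^{-1}:=0$, and let $T_0\ge0$ be any integer such that $\eta_tb_t\le\frac14$ for all $t$ with $T_0<t\le T$. Then also $$R_T\le\sum_{t=1}^T\sum_{i\ne i^*}\frac{\big(\frac72\eta_tb_t^2+2c_t(\eta_t^{-1}-\eta_{t-1}^{-1})\big)^2}{4\Delta_ib_t}+\sum_{t=1}^{T_0}\eta_tb_t^2+2,$$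 where $c_t=2$ if $\frac{5\eta_t}{4}b_t^2\ge2(\eta_t^{-1}-\eta_{t-1}^{-1})$ and $c_t=4$ otherwise. -/

import Mathlib

open MeasureTheory

noncomputable section

namespace TsallisBandit

/-- The objective `⟨p, C⟩ - ∑ i, (4 √(p i) - 2 p i) / η` minimised by the algorithm. -/
def objective {K : ℕ} (η : ℝ) (C p : Fin K → ℝ) : ℝ :=
  ∑ i, p i * C i - ∑ i, (4 * √(p i) - 2 * p i) / η

theorem exists_minimizer {K : ℕ} [NeZero K] (η : ℝ) (C : Fin K → ℝ) :
    ∃ p ∈ stdSimplex ℝ (Fin K), IsMinOn (objective η C) (stdSimplex ℝ (Fin K)) p := by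
  refine (isCompact_stdSimplex ℝ (Fin K)).exists_isMinOn ?_ ?_
  · exact ⟨_, single_mem_stdSimplex ℝ (0 : Fin K)⟩
  · unfold objective
    fun_prop

/-- The minimiser of the objective over the probability simplex. -/
def weights {K : ℕ} [NeZero K] (η : ℝ) (C : Fin K → ℝ) : Fin K → ℝ :=
  (exists_minimizer η C).choose

/-- Cumulative importance-weighted loss estimates after `t` rounds, along a sequence of loss
vectors `ℓ 1, ℓ 2, …` and of played arms `J 1, J 2, …` (the values at index `0` are unused). -/
def cumEst {K : ℕ} [NeZero K] (η : ℕ → ℝ) (ℓ : ℕ → Fin K → ℝ) (J : ℕ → Fin K) :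
    ℕ → Fin K → ℝ
  | 0 => fun _ => 0
  | t + 1 => fun i => cumEst η ℓ J t i +
      if J (t + 1) = i then ℓ (t + 1) i / weights (η (t + 1)) (cumEst η ℓ J t) i else 0

/-- The distribution from which the algorithm draws the arm of round `t ≥ 1`. -/
def armProb {K : ℕ} [NeZero K] (η : ℕ → ℝ) (ℓ : ℕ → Fin K → ℝ) (J : ℕ → Fin K) (t : ℕ) :
    Fin K → ℝ :=
  weights (η t) (cumEst η ℓ J (t - 1))

/-- What happened before round `t`: the loss vectors and the arms of rounds `1, …, t - 1`. -/
abbrev past {Ω : Type*} {K : ℕ} (ℓ : ℕ → Ω → Fin K → ℝ) (J : ℕ → Ω → Fin K) (t : ℕ) :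
    MeasurableSpace Ω :=
  ⨆ s ∈ Finset.Ico 1 t,
    (MeasurableSpace.comap (ℓ s) inferInstance ⊔ MeasurableSpace.comap (J s) inferInstance)

/-- A run of the algorithm: in each round the environment fixes the loss vector (possibly at
random, and possibly depending on the past), and then the arm is drawn from `armProb`,
given the past and the current loss vector. In particular every oblivious environment, whose
whole loss sequence is fixed or drawn before the game, is included. -/
structure IsRun {Ω : Type*} [MeasurableSpace Ω] (μ : Measure Ω) {K : ℕ} [NeZero K]
    (η : ℕ → ℝ) (ℓ : ℕ → Ω → Fin K → ℝ) (J : ℕ → Ω → Fin K) : Prop where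
  measurable_loss : ∀ t, Measurable (ℓ t)
  measurable_arm : ∀ t, Measurable (J t)
  sampling : ∀ t, 1 ≤ t → ∀ i,
    μ[(J t ⁻¹' {i}).indicator (fun _ => (1 : ℝ)) |
        past ℓ J t ⊔ MeasurableSpace.comap (ℓ t) inferInstance]
      =ᵐ[μ] fun ω => armProb η (fun s => ℓ s ω) (fun s => J s ω) t i

/-- `𝔼[∑_{t ≤ T} ℓ_{t, J_t}] - min_i 𝔼[∑_{t ≤ T} ℓ_{t, i}]`. -/
def pseudoRegret {Ω : Type*} [MeasurableSpace Ω] (μ : Measure Ω) {K : ℕ}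
    (ℓ : ℕ → Ω → Fin K → ℝ) (J : ℕ → Ω → Fin K) (T : ℕ) : ℝ :=
  (∫ ω, ∑ t ∈ Finset.Icc 1 T, ℓ t ω (J t ω) ∂μ)
    - ⨅ i, ∫ ω, ∑ t ∈ Finset.Icc 1 T, ℓ t ω i ∂μ

/-- The stochastically constrained adversarial regime for losses of range `b t`: given the past,
the expected loss difference of arms `i` and `j` in round `t`, in units of `b t`, is the constant
`D i j`. The expected losses themselves may fluctuate. -/
def IsStochConstrained {Ω : Type*} [MeasurableSpace Ω] (μ : Measure Ω) {K : ℕ} (b : ℕ → ℝ)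
    (D : Fin K → Fin K → ℝ) (ℓ : ℕ → Ω → Fin K → ℝ) (J : ℕ → Ω → Fin K) : Prop :=
  ∀ t, 1 ≤ t → ∀ i j, μ[fun ω => ℓ t ω i - ℓ t ω j | past ℓ J t] =ᵐ[μ] fun _ => b t * D i j

/-- The suboptimality gaps `Δ_i = D i 1 - min_j D j 1` (the first arm has index `0` in `Fin K`). -/
def gap {K : ℕ} [NeZero K] (D : Fin K → Fin K → ℝ) (i : Fin K) : ℝ :=
  D i 0 - ⨅ j, D j 0

/-- `η_t⁻¹ - η_{t-1}⁻¹`, with the convention `η_0⁻¹ = 0`. -/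
def invRateStep (η : ℕ → ℝ) (t : ℕ) : ℝ :=
  (η t)⁻¹ - if t = 1 then 0 else (η (t - 1))⁻¹

/-- The constant `c ∈ {2, 4}` of round `t`. -/
def stepConst (η b : ℕ → ℝ) (t : ℕ) : ℝ :=
  if 2 * invRateStep η t ≤ 5 * η t / 4 * b t ^ 2 then 2 else 4

end TsallisBandit

end

/-! This is a follow-the-regularised-leader analysis. Along each path, the learner's loss splits
into stability terms (the loss minus the growth of the minimal objective at a fixed rate) and
penalty terms `4 * (η_t⁻¹ - η_{t-1}⁻¹) * (∑ √p - 1)`, which come from changing the rate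
(`sum_loss_le`). The estimates are unbiased, so after taking expectations the comparator term
becomes the true loss of a fixed arm (`integral_cumEst`, `regret_le`).

Stability is bounded without convex duality. First-order optimality makes the objective grow around
its minimiser at least like a weighted squared distance between square roots (`objective_growth`),
and completing a square in each coordinate finishes (`stability_le`). Adding a constant to all
losses does not move the minimiser, so a shift `c` is free. With `c = 0`, drawing arm `j` costs at
most `η b² / (2 √p_j)`. This averages to `η b² / 2 * ∑ √p`, at most `η b² √K / 2`; since the
penalties telescope, the adversarial bound follows.

For the stochastic bound, the shift `c = ℓ_j` is used when the best arm is drawn and `η b ≤ 1/4`.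
Its cost then carries a factor `1 - p_{i*}`, the total mass of the other arms. The penalty also
reduces to suboptimal arms, because `√x - 1 ≤ -(1 - x) / 2`. So, up to the early rounds, the regret
`R` is at most the expectation of `∑ A_t √p_{t,i}` over suboptimal arms (`regret_le_sum_sqrt`). It
also equals the expectation of `∑ Δ_i b_t p_{t,i}` (`pseudoRegret_eq_gap`). Writing `R = 2R - R` and
maximising `2 A x - Δ b x²` over `x = √p` gives the claim. -/

namespace TsallisBandit

/-! ### The minimiser: optimality, positivity and Lipschitz dependence on the losses -/

section Deterministic

variable {K : ℕ}

theorem le_one_of_mem_stdSimplex {p : Fin K → ℝ} (hp : p ∈ stdSimplex ℝ (Fin K)) (i : Fin K) :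
    p i ≤ 1 := by
  rw [← hp.2]
  exact Finset.single_le_sum (fun j _ => hp.1 j) (Finset.mem_univ i)

theorem objective_eq_of_mem (η : ℝ) (C : Fin K → ℝ) {p : Fin K → ℝ}
    (hp : p ∈ stdSimplex ℝ (Fin K)) :
    objective η C p = ∑ i, p i * C i - (4 * ∑ i, √(p i) - 2) / η := by
  rw [objective, ← Finset.sum_div, Finset.sum_sub_distrib, ← Finset.mul_sum, ← Finset.mul_sum,
    hp.2, mul_one]

variable [NeZero K]

theorem weights_mem (η : ℝ) (C : Fin K → ℝ) : weights η C ∈ stdSimplex ℝ (Fin K) :=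
  (exists_minimizer η C).choose_spec.1

theorem objective_weights_le (η : ℝ) (C : Fin K → ℝ) {q : Fin K → ℝ}
    (hq : q ∈ stdSimplex ℝ (Fin K)) : objective η C (weights η C) ≤ objective η C q :=
  (exists_minimizer η C).choose_spec.2 hq

/-- Moving from the minimiser towards `q` by a fraction `s` does not decrease the objective. -/
theorem sum_sqrt_segment_le {η : ℝ} (C : Fin K → ℝ) {q : Fin K → ℝ}
    (hq : q ∈ stdSimplex ℝ (Fin K)) {s : ℝ} (hs0 : 0 ≤ s) (hs1 : s ≤ 1) :
    4 / η * ∑ i, (√(weights η C i + s * (q i - weights η C i)) - √(weights η C i))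
      ≤ s * ∑ i, (q i - weights η C i) * C i := by
  set p := weights η C with hp
  have hpm : p ∈ stdSimplex ℝ (Fin K) := weights_mem η C
  have hmem : (fun i => p i + s * (q i - p i)) ∈ stdSimplex ℝ (Fin K) := by
    constructor
    · intro i
      have h1 := hpm.1 i
      have h2 := hq.1 i
      nlinarith
    · rw [Finset.sum_add_distrib, ← Finset.mul_sum, Finset.sum_sub_distrib, hpm.2, hq.2]
      ring
  have h := objective_weights_le η C hmem
  rw [← hp, objective_eq_of_mem η C hpm, objective_eq_of_mem η C hmem] at h
  have e1 : ∑ i, (p i + s * (q i - p i)) * C i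
      = ∑ i, p i * C i + s * ∑ i, (q i - p i) * C i := by
    rw [Finset.mul_sum, ← Finset.sum_add_distrib]
    exact Finset.sum_congr rfl fun i _ => by ring
  rw [e1] at h
  rw [Finset.sum_sub_distrib]
  simp only [sub_div] at h
  have e2 : 4 / η * (∑ i, √(p i + s * (q i - p i)) - ∑ i, √(p i))
    = 4 * (∑ i, √(p i + s * (q i - p i))) / η - 4 * (∑ i, √(p i)) / η := by ring
  rw [e2]
  linarith

/-- The square root has infinite slope at zero: moving a fraction `r²` towards an arm of mass zero
gains `r` in `∑ √p`, while every other change is of order `r²`. For small `r` this contradicts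
minimality. -/
theorem weights_pos {η : ℝ} (hη : 0 < η) (C : Fin K → ℝ) (i : Fin K) : 0 < weights η C i := by
  by_contra hneg
  set p := weights η C with hp
  have hpm : p ∈ stdSimplex ℝ (Fin K) := weights_mem η C
  have hpi : p i = 0 := le_antisymm (not_lt.1 hneg) (hpm.1 i)
  set M := ∑ j, ((Pi.single i 1 : Fin K → ℝ) j - p j) * C j with hM
  have key : ∀ r : ℝ, 0 < r → r ≤ 1 → 4 / η ≤ r * (M + 4 / η * K) := by
    intro r hr0 hr1
    have h := sum_sqrt_segment_le (η := η) C (single_mem_stdSimplex ℝ i) (sq_nonneg r)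
      (by nlinarith : r ^ 2 ≤ 1)
    rw [← hp] at h
    have hlow : r - r ^ 2 * K ≤ ∑ j, (√(p j + r ^ 2 * ((Pi.single i 1 : Fin K → ℝ) j - p j)) - √(p j)) := by
      have e : r - r ^ 2 * K = ∑ j, ((Pi.single i r : Fin K → ℝ) j - r ^ 2) := by
        rw [Finset.sum_sub_distrib, Finset.sum_pi_single']
        simp [mul_comm]
      rw [e]
      refine Finset.sum_le_sum fun j _ => ?_
      by_cases hj : j = i
      · subst hj
        simp [hpi, Real.sqrt_sq hr0.le]
        positivity
      · simp only [Pi.single_eq_of_ne hj]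
        have h1 : √(p j) * (1 - r ^ 2) ≤ √(p j + r ^ 2 * (0 - p j)) := by
          apply Real.le_sqrt_of_sq_le
          rw [mul_pow, Real.sq_sqrt (hpm.1 j)]
          have : r ^ 2 ≤ 1 := by nlinarith
          have h0 := hpm.1 j
          have : p j * ((1 - r ^ 2) ^ 2) ≤ p j * (1 - r ^ 2) := by
            apply mul_le_mul_of_nonneg_left _ h0
            nlinarith [sq_nonneg r]
          linarith
        have h2 : √(p j) ≤ 1 := Real.sqrt_le_one.2 (le_one_of_mem_stdSimplex hpm j)
        nlinarith [sq_nonneg r]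
    have h3 := (mul_le_mul_of_nonneg_left hlow (by positivity : 0 ≤ 4 / η)).trans h
    rw [← hM] at h3
    have h4 : r * (4 / η) ≤ r * (r * (M + 4 / η * K)) := by nlinarith
    exact le_of_mul_le_mul_left h4 hr0
  set N := M + 4 / η * K
  have hη4 : 0 < 4 / η := by positivity
  have hN : 0 < N := by
    have := key 1 one_pos le_rfl
    linarith
  -- With this `r`, `r * N ≤ 2 / η`, whereas `key` demands `r * N ≥ 4 / η`.
  have hr : 0 < min 1 (2 / η / N) := by positivity
  have h5 := key _ hr (min_le_left _ _)
  have h6 : min 1 (2 / η / N) * N ≤ 2 / η / N * N :=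
    mul_le_mul_of_nonneg_right (min_le_right _ _) hN.le
  rw [div_mul_cancel₀ _ hN.ne'] at h6
  have h7 : 2 / η < 4 / η := by gcongr; norm_num
  linarith

/-- A second-order lower bound for the square root. -/
theorem sqrt_add_ge {a h : ℝ} (ha : 0 < a) (hh : 0 ≤ a ^ 2 + h) :
    a + h / (2 * a) - h ^ 2 / (2 * a ^ 3) ≤ √(a ^ 2 + h) := by
  obtain ⟨y, hy, hy2⟩ : ∃ y : ℝ, 0 ≤ y ∧ y ^ 2 = a ^ 2 + h := ⟨_, Real.sqrt_nonneg _, Real.sq_sqrt hh⟩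
  rw [← hy2, Real.sqrt_sq hy]
  obtain rfl : h = y ^ 2 - a ^ 2 := by linarith
  have : y - (a + (y ^ 2 - a ^ 2) / (2 * a) - (y ^ 2 - a ^ 2) ^ 2 / (2 * a ^ 3))
      = (y - a) ^ 2 * (y ^ 2 + 2 * a * y) / (2 * a ^ 3) := by
    field_simp
    ring
  have h2 : 0 ≤ (y - a) ^ 2 * (y ^ 2 + 2 * a * y) / (2 * a ^ 3) := by positivity
  linarith

/-- First-order optimality of the minimiser. -/
theorem first_order {η : ℝ} (hη : 0 < η) (C : Fin K → ℝ) {q : Fin K → ℝ}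
    (hq : q ∈ stdSimplex ℝ (Fin K)) :
    2 / η * ∑ i, (q i - weights η C i) / √(weights η C i)
      ≤ ∑ i, (q i - weights η C i) * C i := by
  set p := weights η C with hp
  have hpm : p ∈ stdSimplex ℝ (Fin K) := weights_mem η C
  have hpos : ∀ i, 0 < p i := weights_pos hη C
  set S := ∑ i, (q i - p i) ^ 2 / (2 * √(p i) ^ 3)
  have key : ∀ s : ℝ, 0 < s → s ≤ 1 →
      2 / η * ∑ i, (q i - p i) / √(p i) - s * (4 / η * S) ≤ ∑ i, (q i - p i) * C i := by
    intro s hs0 hs1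
    have h := sum_sqrt_segment_le (η := η) C hq hs0.le hs1
    rw [← hp] at h
    have hlow : s * (∑ i, (q i - p i) / √(p i)) / 2 - s ^ 2 * S
        ≤ ∑ j, (√(p j + s * (q j - p j)) - √(p j)) := by
      rw [Finset.mul_sum, Finset.sum_div, Finset.mul_sum, ← Finset.sum_sub_distrib]
      refine Finset.sum_le_sum fun j _ => ?_
      have ha : 0 < √(p j) := Real.sqrt_pos.2 (hpos j)
      have hsq := Real.sq_sqrt (hpos j).le
      have hnn : 0 ≤ √(p j) ^ 2 + s * (q j - p j) := by
        rw [hsq]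
        nlinarith [hpos j, hq.1 j]
      have := sqrt_add_ge ha hnn
      rw [hsq] at this
      have e : s * ((q j - p j) / √(p j)) / 2 - s ^ 2 * ((q j - p j) ^ 2 / (2 * √(p j) ^ 3))
        = s * (q j - p j) / (2 * √(p j)) - (s * (q j - p j)) ^ 2 / (2 * √(p j) ^ 3) := by ring
      rw [e]
      linarith
    have h3 := (mul_le_mul_of_nonneg_left hlow (by positivity : 0 ≤ 4 / η)).trans h
    have h4 : s * (2 / η * ∑ i, (q i - p i) / √(p i) - s * (4 / η * S))
        ≤ s * ∑ i, (q i - p i) * C i := by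
      refine le_trans (le_of_eq ?_) h3
      ring
    exact le_of_mul_le_mul_left h4 hs0
  -- The factor `s` has been divided out; letting `s` tend to zero from the right removes the
  -- second-order term.
  have hlim : Filter.Tendsto
      (fun s : ℝ => 2 / η * ∑ i, (q i - p i) / √(p i) - s * (4 / η * S)) (nhdsWithin 0 (Set.Ioi 0))
      (nhds (2 / η * ∑ i, (q i - p i) / √(p i) - 0 * (4 / η * S))) := by
    apply Filter.Tendsto.mono_left _ nhdsWithin_le_nhds
    exact Continuous.tendsto (by fun_prop) 0
  rw [zero_mul, sub_zero] at hlim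
  refine le_of_tendsto hlim ?_
  filter_upwards [Ioc_mem_nhdsGT (zero_lt_one' ℝ)] with s hs using key s hs.1 hs.2

/-- The objective grows around its minimiser at least like the Bregman divergence. -/
theorem objective_growth {η : ℝ} (hη : 0 < η) (C : Fin K → ℝ) {q : Fin K → ℝ}
    (hq : q ∈ stdSimplex ℝ (Fin K)) :
    2 / η * ∑ i, (√(q i) - √(weights η C i)) ^ 2 / √(weights η C i)
      ≤ objective η C q - objective η C (weights η C) := by
  have hfo := first_order hη C hq
  have hpos := weights_pos hη C
  have hpm := weights_mem η C
  set p := weights η C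
  rw [objective_eq_of_mem η C hq, objective_eq_of_mem η C hpm]
  -- Expanding the square isolates exactly the linear term controlled by `first_order`.
  have e : ∑ i, (√(q i) - √(p i)) ^ 2 / √(p i)
      = ∑ i, (q i - p i) / √(p i) - 2 * (∑ i, √(q i) - ∑ i, √(p i)) := by
    rw [← Finset.sum_sub_distrib, Finset.mul_sum, ← Finset.sum_sub_distrib]
    refine Finset.sum_congr rfl fun i _ => ?_
    have ha : 0 < √(p i) := Real.sqrt_pos.2 (hpos i)
    have h1 := Real.sq_sqrt (hpos i).le
    have h2 := Real.sq_sqrt (hq.1 i)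
    nth_rw 3 [← h1]
    nth_rw 2 [← h2]
    field_simp
    ring
  rw [e]
  have e2 : ∑ i, (q i - p i) * C i = ∑ i, q i * C i - ∑ i, p i * C i := by
    rw [← Finset.sum_sub_distrib]
    exact Finset.sum_congr rfl fun i _ => by ring
  rw [e2] at hfo
  have e3 : 2 / η * (∑ i, (q i - p i) / √(p i) - 2 * (∑ i, √(q i) - ∑ i, √(p i)))
    = 2 / η * ∑ i, (q i - p i) / √(p i)
      - ((4 * ∑ i, √(q i) - 2) / η - (4 * ∑ i, √(p i) - 2) / η) := by ring
  rw [e3]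
  linarith

/-- First-order optimality is tested against the vertex of arm `i`; nonnegative losses allow `⟨p,
C⟩` to be dropped. The crude bound `∑ √p ≤ K` suffices, since this only serves to keep importance
weights bounded, hence integrable. -/
theorem inv_sqrt_weights_le {η : ℝ} (hη : 0 < η) {C : Fin K → ℝ} (hC : ∀ i, 0 ≤ C i)
    (i : Fin K) : 1 / √(weights η C i) ≤ η / 2 * C i + K := by
  have hfo := first_order hη C (single_mem_stdSimplex ℝ i)
  have hpos := weights_pos hη C
  have hpm := weights_mem η C
  set p := weights η C
  have e1 : ∑ j, ((Pi.single i 1 : Fin K → ℝ) j - p j) / √(p j) = 1 / √(p i) - ∑ j, √(p j) := by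
    simp only [sub_div, Real.div_sqrt]
    rw [Finset.sum_sub_distrib]
    congr 1
    rw [Finset.sum_eq_single i]
    · simp
    · intro j _ hj
      simp [hj]
    · simp
  have e2 : ∑ j, ((Pi.single i 1 : Fin K → ℝ) j - p j) * C j ≤ C i := by
    simp only [sub_mul]
    rw [Finset.sum_sub_distrib]
    have : 0 ≤ ∑ j, p j * C j := Finset.sum_nonneg fun j _ => mul_nonneg (hpos j).le (hC j)
    have : ∑ j, (Pi.single i 1 : Fin K → ℝ) j * C j = C i := by
      rw [Finset.sum_eq_single i]
      · simp
      · intro j _ hj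
        simp [hj]
      · simp
    linarith
  have e3 : ∑ j, √(p j) ≤ K := by
    calc ∑ j, √(p j) ≤ ∑ _j : Fin K, (1 : ℝ) :=
          Finset.sum_le_sum fun j _ => Real.sqrt_le_one.2 (le_one_of_mem_stdSimplex hpm j)
      _ = K := by simp
  rw [e1] at hfo
  have h := mul_le_mul_of_nonneg_left (hfo.trans e2) (by positivity : 0 ≤ η / 2)
  have e4 : η / 2 * (2 / η * (1 / √(p i) - ∑ j, √(p j))) = 1 / √(p i) - ∑ j, √(p j) := by
    field_simp
  rw [e4] at h
  linarith

/-- Since probabilities are at most one, `objective_growth` implies quadratic growth in `q - p`.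
Adding the growth bounds for `C` and `C'` cancels the regularisers and leaves the pairing of `p -
p'` with `C - C'`, hence a Lipschitz bound. It is needed for measurability of the sampling
probabilities. -/
theorem continuous_weights {η : ℝ} (hη : 0 < η) :
    Continuous (weights η : (Fin K → ℝ) → Fin K → ℝ) := by
  have key : ∀ C q, q ∈ stdSimplex ℝ (Fin K) → 1 / (2 * η) * ∑ i, (q i - weights η C i) ^ 2
      ≤ objective η C q - objective η C (weights η C) := by
    intro C q hq
    refine le_trans ?_ (objective_growth hη C hq)
    have hpos := weights_pos hη C
    have hpm := weights_mem η C
    set p := weights η C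
    rw [Finset.mul_sum, Finset.mul_sum]
    refine Finset.sum_le_sum fun i _ => ?_
    have ha : 0 < √(p i) := Real.sqrt_pos.2 (hpos i)
    have ha1 : √(p i) ≤ 1 := Real.sqrt_le_one.2 (le_one_of_mem_stdSimplex hpm i)
    have hb1 : √(q i) ≤ 1 := Real.sqrt_le_one.2 (le_one_of_mem_stdSimplex hq i)
    have hb := Real.sqrt_nonneg (q i)
    have h1 : (√(q i) - √(p i)) ^ 2 ≤ (√(q i) - √(p i)) ^ 2 / √(p i) :=
      le_div_self (sq_nonneg _) ha ha1
    have h2 : (q i - p i) ^ 2 ≤ 4 * (√(q i) - √(p i)) ^ 2 := by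
      have e : q i - p i = (√(q i) + √(p i)) * (√(q i) - √(p i)) := by
        rw [← sq_sub_sq, Real.sq_sqrt (hpos i).le, Real.sq_sqrt (hq.1 i)]
      rw [e, mul_pow]
      have : (√(q i) + √(p i)) ^ 2 ≤ 4 := by nlinarith
      exact mul_le_mul_of_nonneg_right this (sq_nonneg _)
    calc 1 / (2 * η) * (q i - p i) ^ 2
        ≤ 1 / (2 * η) * (4 * ((√(q i) - √(p i)) ^ 2 / √(p i))) := by gcongr; linarith
      _ = _ := by ring
  have hlip : LipschitzWith (Real.toNNReal (η * K)) (weights η : (Fin K → ℝ) → Fin K → ℝ) := by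
    refine LipschitzWith.of_dist_le_mul fun C C' => ?_
    rw [Real.coe_toNNReal _ (by positivity), dist_eq_norm, dist_eq_norm]
    have h1 := key C _ (weights_mem η C')
    have h2 := key C' _ (weights_mem η C)
    set p := weights η C
    set p' := weights η C'
    rw [objective, objective] at h1 h2
    set m := ‖p - p'‖
    have hsq : m ^ 2 ≤ ∑ i, (p i - p' i) ^ 2 := by
      obtain ⟨i, hi⟩ : ∃ i, m = ‖(p - p') i‖ := by
        obtain ⟨i, _, hi⟩ := Finset.exists_max_image Finset.univ (fun i => ‖(p - p') i‖)
          ⟨0, Finset.mem_univ _⟩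
        refine ⟨i, le_antisymm ?_ (norm_le_pi_norm _ i)⟩
        exact (pi_norm_le_iff_of_nonneg (norm_nonneg _)).2 fun j => hi j (Finset.mem_univ j)
      rw [hi, Real.norm_eq_abs, sq_abs]
      exact Finset.single_le_sum (f := fun i => (p i - p' i) ^ 2) (fun j _ => sq_nonneg _)
        (Finset.mem_univ i)
    have hsq' : ∑ i, (p' i - p i) ^ 2 = ∑ i, (p i - p' i) ^ 2 :=
      Finset.sum_congr rfl fun i _ => by ring
    have hlin : ∑ i, p' i * C i - ∑ i, p i * C i + (∑ i, p i * C' i - ∑ i, p' i * C' i)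
        ≤ K * (m * ‖C - C'‖) := by
      rw [← Finset.sum_sub_distrib, ← Finset.sum_sub_distrib, ← Finset.sum_add_distrib]
      calc _ ≤ ∑ _i : Fin K, m * ‖C - C'‖ := by
            refine Finset.sum_le_sum fun i _ => ?_
            have e : p' i * C i - p i * C i + (p i * C' i - p' i * C' i)
              = - ((p - p') i * (C - C') i) := by simp only [Pi.sub_apply]; ring
            rw [e]
            refine (neg_le_abs _).trans ?_
            rw [abs_mul]
            exact mul_le_mul (norm_le_pi_norm (p - p') i) (norm_le_pi_norm (C - C') i)
              (abs_nonneg _) (norm_nonneg _)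
        _ = K * (m * ‖C - C'‖) := by simp
    rw [hsq'] at h1
    have h3 : 1 / η * m ^ 2 ≤ K * (m * ‖C - C'‖) := by
      have : 1 / η * m ^ 2 ≤ 1 / η * ∑ i, (p i - p' i) ^ 2 := by gcongr
      have e : 1 / η * ∑ i, (p i - p' i) ^ 2 = 1 / (2 * η) * ∑ i, (p i - p' i) ^ 2
        + 1 / (2 * η) * ∑ i, (p i - p' i) ^ 2 := by field_simp; ring
      linarith
    rcases (norm_nonneg (p - p')).eq_or_lt with h0 | h0
    · change m ≤ _
      rw [show m = 0 from h0.symm]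
      positivity
    · have h4 : m * m ≤ m * (η * K * ‖C - C'‖) := by
        have := mul_le_mul_of_nonneg_left h3 hη.le
        have e : η * (1 / η * m ^ 2) = m * m := by field_simp
        rw [e] at this
        linarith
      exact le_of_mul_le_mul_left h4 h0
  exact hlip.continuous

theorem measurable_weights {η : ℝ} (hη : 0 < η) (i : Fin K) :
    Measurable (fun C : Fin K → ℝ => weights η C i) :=
  ((continuous_apply i).comp (continuous_weights hη)).measurable

end Deterministic

/-! ### Stability of the minimal value in one round -/

section Stability

variable {K : ℕ}

/-- The importance-weighted estimate of the losses has mean `ℓ j` under `p` if arm `j` is played. -/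
theorem sum_mul_estimate {p : Fin K → ℝ} (hp : ∀ i, 0 < p i) (ℓ : Fin K → ℝ) (j : Fin K) :
    ∑ i, p i * (if j = i then ℓ i / p i else 0) = ℓ j := by
  rw [Finset.sum_eq_single j]
  · rw [if_pos rfl, mul_div_cancel₀ _ (hp j).ne']
  · intro i _ hi
    rw [if_neg hi.symm, mul_zero]
  · simp

variable [NeZero K]

/-- The stability of the minimal value under a perturbation `L` of the losses; shifting all
losses by a constant `c` changes nothing. -/
theorem stability_le {η : ℝ} (hη : 0 < η) (C L : Fin K → ℝ) (c : ℝ)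
    (hc : ∀ i, 0 < 2 / (η * √(weights η C i)) + (L i - c)) :
    objective η C (weights η C) + ∑ i, weights η C i * L i
        - objective η (fun i => C i + L i) (weights η fun i => C i + L i)
      ≤ ∑ i, weights η C i * (L i - c) ^ 2 / (2 / (η * √(weights η C i)) + (L i - c)) := by
  have hqm := weights_mem η (fun i => C i + L i)
  set q := weights η fun i => C i + L i
  have hg := objective_growth hη C hqm
  have hpos := weights_pos hη C
  have hpm := weights_mem η C
  set p := weights η C
  have e1 : objective η (fun i => C i + L i) q = objective η C q + ∑ i, q i * L i := by
    simp only [objective, mul_add, Finset.sum_add_distrib]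
    ring
  have e2 : ∑ i, p i * L i - ∑ i, q i * L i = ∑ i, (p i - q i) * (L i - c) := by
    have : ∑ i, (p i - q i) * (L i - c)
        = ∑ i, p i * L i - ∑ i, q i * L i - (∑ i, p i - ∑ i, q i) * c := by
      rw [← Finset.sum_sub_distrib, ← Finset.sum_sub_distrib, Finset.sum_mul,
        ← Finset.sum_sub_distrib]
      exact Finset.sum_congr rfl fun i _ => by ring
    rw [this, hpm.2, hqm.2]
    ring
  have e3 : ∑ i, (p i - q i) * (L i - c) - 2 / η * ∑ i, (√(q i) - √(p i)) ^ 2 / √(p i)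
      ≤ ∑ i, p i * (L i - c) ^ 2 / (2 / (η * √(p i)) + (L i - c)) := by
    rw [Finset.mul_sum, ← Finset.sum_sub_distrib]
    refine Finset.sum_le_sum fun i _ => ?_
    rw [le_div_iff₀ (hc i)]
    have ha : 0 < √(p i) := Real.sqrt_pos.2 (hpos i)
    have h1 := Real.sq_sqrt (hpos i).le
    have h2 := Real.sq_sqrt (hqm.1 i)
    have hu : 2 / η * ((√(q i) - √(p i)) ^ 2 / √(p i))
        = 2 / (η * √(p i)) * (√(q i) - √(p i)) ^ 2 := by field_simp
    rw [hu]
    -- Completing the square in `y`: as `u + x > 0`, the left factor is concave in `y` and is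
    -- maximal at `y = a * u / (u + x)`.
    have aux : ∀ a y u x : ℝ, ((a ^ 2 - y ^ 2) * x - u * (y - a) ^ 2) * (u + x) ≤ a ^ 2 * x ^ 2 :=
      fun a y u x => by nlinarith [sq_nonneg (a * x + (u + x) * (y - a))]
    have := aux √(p i) √(q i) (2 / (η * √(p i))) (L i - c)
    rwa [h1, h2] at this
  linarith

theorem stability_estimate_le {η b : ℝ} (hη : 0 < η) (C : Fin K → ℝ) {ℓ : Fin K → ℝ}
    (hℓ : ∀ i, ℓ i ∈ Set.Icc 0 b) (j : Fin K) :
    objective η C (weights η C) + ℓ j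
        - objective η (fun i => C i + if j = i then ℓ i / weights η C i else 0)
          (weights η fun i => C i + if j = i then ℓ i / weights η C i else 0)
      ≤ η / 2 * b ^ 2 / √(weights η C j) := by
  have hpos := weights_pos hη C
  have hs := stability_le hη C (fun i => if j = i then ℓ i / weights η C i else 0) 0 (by
    intro i
    have ha : 0 < √(weights η C i) := Real.sqrt_pos.2 (hpos i)
    have h0 := (hℓ i).1
    have h1 := hpos i
    have : 0 ≤ (if j = i then ℓ i / weights η C i else 0) := by split_ifs <;> positivity
    have : 0 < 2 / (η * √(weights η C i)) := by positivity
    linarith)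
  rw [sum_mul_estimate hpos] at hs
  refine hs.trans ?_
  set p := weights η C
  rw [Finset.sum_eq_single j]
  · have ha : 0 < √(p j) := Real.sqrt_pos.2 (hpos j)
    have h1 := Real.sq_sqrt (hpos j).le
    have h0 := (hℓ j).1
    simp only [if_true, sub_zero]
    have hx : 0 ≤ ℓ j / p j := div_nonneg h0 (hpos j).le
    calc p j * (ℓ j / p j) ^ 2 / (2 / (η * √(p j)) + ℓ j / p j)
        ≤ p j * (ℓ j / p j) ^ 2 / (2 / (η * √(p j))) := by
          have := hpos j
          gcongr
          linarith
      _ = η / 2 * ℓ j ^ 2 / √(p j) := by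
          rw [← h1, Real.sqrt_sq ha.le]
          field_simp
      _ ≤ η / 2 * b ^ 2 / √(p j) := by
          have := (hℓ j).2
          gcongr
  · intro i _ hi
    simp [hi.symm]
  · simp

/-- Shifting by `c = ℓ j` turns the estimate of the drawn arm into `ℓ j * (1 - p j) / p j`, which
produces the factor `1 - p j`. The price is a loss of `-ℓ j` on every other arm, harmless when `η *
b` is small. -/
theorem stability_estimate_best_le {η b : ℝ} (hη : 0 < η) (C : Fin K → ℝ) {ℓ : Fin K → ℝ}
    (hℓ : ∀ i, ℓ i ∈ Set.Icc 0 b) (hηb : η * b ≤ 1 / 4) (j : Fin K) :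
    objective η C (weights η C) + ℓ j
        - objective η (fun i => C i + if j = i then ℓ i / weights η C i else 0)
          (weights η fun i => C i + if j = i then ℓ i / weights η C i else 0)
      ≤ η / 2 * b ^ 2 * (1 - weights η C j) / √(weights η C j)
        + ∑ i ∈ Finset.univ.erase j, 4 / 7 * η * b ^ 2 * weights η C i := by
  have hpos := weights_pos hη C
  have hpm := weights_mem η C
  have hle : ∀ i, weights η C i ≤ 1 := le_one_of_mem_stdSimplex hpm
  have h0 := (hℓ j).1
  have hb := (hℓ j).2
  -- Since `η * b ≤ 1/4` and `√p ≤ 1`, the shift is at most an eighth of `2 / (η √p)`. The remaining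
  -- `7/4` is the origin of the constant `4/7`.
  have hu : ∀ i, 7 / (4 * (η * √(weights η C i))) ≤ 2 / (η * √(weights η C i)) - ℓ j := by
    intro i
    have ha : 0 < √(weights η C i) := Real.sqrt_pos.2 (hpos i)
    have ha1 : √(weights η C i) ≤ 1 := Real.sqrt_le_one.2 (hle i)
    have h1 : ℓ j ≤ 1 / (4 * (η * √(weights η C i))) := by
      rw [le_div_iff₀ (by positivity)]
      have h2 : η * ℓ j ≤ 1 / 4 := (mul_le_mul_of_nonneg_left hb hη.le).trans hηb
      have h3 : η * ℓ j * √(weights η C i) ≤ η * ℓ j * 1 :=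
        mul_le_mul_of_nonneg_left ha1 (by positivity)
      linarith
    have e : 7 / (4 * (η * √(weights η C i)))
      = 2 / (η * √(weights η C i)) - 1 / (4 * (η * √(weights η C i))) := by field_simp; norm_num
    rw [e]
    linarith
  have hx : 0 ≤ ℓ j / weights η C j - ℓ j := by
    have : ℓ j ≤ ℓ j / weights η C j := le_div_self h0 (hpos j) (hle j)
    linarith
  have hs := stability_le hη C (fun i => if j = i then ℓ i / weights η C i else 0) (ℓ j) (by
    intro i
    have ha : 0 < √(weights η C i) := Real.sqrt_pos.2 (hpos i)
    by_cases hij : j = i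
    · subst hij
      rw [if_pos rfl]
      have : 0 < 2 / (η * √(weights η C j)) := by positivity
      linarith
    · rw [if_neg hij]
      have h1 := hu i
      have : 0 < 7 / (4 * (η * √(weights η C i))) := by positivity
      linarith)
  rw [sum_mul_estimate hpos] at hs
  refine hs.trans ?_
  set p := weights η C
  rw [← Finset.add_sum_erase _ _ (Finset.mem_univ j)]
  refine add_le_add ?_ (Finset.sum_le_sum fun i hi => ?_)
  · have ha : 0 < √(p j) := Real.sqrt_pos.2 (hpos j)
    have h1 := Real.sq_sqrt (hpos j).le
    rw [if_pos rfl]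
    have hp0 := hpos j
    have hp1 : 0 ≤ 1 - p j := sub_nonneg.2 (hle j)
    calc p j * (ℓ j / p j - ℓ j) ^ 2 / (2 / (η * √(p j)) + (ℓ j / p j - ℓ j))
        ≤ p j * (ℓ j / p j - ℓ j) ^ 2 / (2 / (η * √(p j))) := by
          gcongr
          linarith
      _ = η / 2 * ℓ j ^ 2 * (1 - p j) ^ 2 / √(p j) := by
          rw [← h1, Real.sqrt_sq ha.le]
          field_simp
      _ ≤ η / 2 * b ^ 2 * (1 - p j) / √(p j) := by
          gcongr
          nlinarith
  · have ha : 0 < √(p i) := Real.sqrt_pos.2 (hpos i)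
    have hp0 := hpos i
    rw [if_neg (Finset.ne_of_mem_erase hi).symm]
    calc p i * (0 - ℓ j) ^ 2 / (2 / (η * √(p i)) + (0 - ℓ j))
        ≤ p i * (0 - ℓ j) ^ 2 / (7 / (4 * (η * √(p i)))) := by
          gcongr
          have := hu i
          linarith
      _ = 4 / 7 * η * ℓ j ^ 2 * p i * √(p i) := by
          field_simp
          ring
      _ ≤ 4 / 7 * η * b ^ 2 * p i * 1 := by
          gcongr
          exact Real.sqrt_le_one.2 (hle i)
      _ = _ := by ring

end Stability

/-! ### Telescoping along a path and deterministic bounds on the estimates -/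

section Pathwise

variable {K : ℕ} [NeZero K]

theorem sum_invRateStep (η : ℕ → ℝ) (T : ℕ) (hT : 1 ≤ T) :
    ∑ t ∈ Finset.Icc 1 T, invRateStep η t = (η T)⁻¹ := by
  induction T, hT using Nat.le_induction with
  | base => simp [invRateStep]
  | succ T hT ih =>
    rw [Finset.sum_Icc_succ_top (by omega), ih, invRateStep, if_neg (by omega)]
    simp

theorem invRateStep_nonneg {η : ℕ → ℝ} (hη_pos : ∀ t, 1 ≤ t → 0 < η t)
    (hη_anti : ∀ s t, 1 ≤ s → s ≤ t → η t ≤ η s) {t : ℕ} (ht : 1 ≤ t) : 0 ≤ invRateStep η t := by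
  unfold invRateStep
  split_ifs with h
  · simpa using (hη_pos t ht).le
  · exact sub_nonneg.2 (inv_anti₀ (hη_pos t ht) (hη_anti (t - 1) t (by omega) (by omega)))

/-- Decomposition of the cumulative loss along a path into stability and penalty terms. -/
theorem sum_loss_le (η : ℕ → ℝ) (ℓ : ℕ → Fin K → ℝ) (J : ℕ → Fin K)
    (G : ℕ → ℝ)
    (hG : ∀ t, objective (η (t + 1)) (cumEst η ℓ J t) (armProb η ℓ J (t + 1))
        + ℓ (t + 1) (J (t + 1))
        - objective (η (t + 1)) (cumEst η ℓ J (t + 1))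
          (weights (η (t + 1)) (cumEst η ℓ J (t + 1))) ≤ G (t + 1))
    (T : ℕ) (hT : 1 ≤ T) (i : Fin K) :
    ∑ t ∈ Finset.Icc 1 T, ℓ t (J t)
      ≤ ∑ t ∈ Finset.Icc 1 T,
          (G t + 4 * invRateStep η t * (∑ k, √(armProb η ℓ J t k) - 1)) + cumEst η ℓ J T i := by
  -- The added `2 / η T` normalises the regulariser to `4 * (∑ √p - 1) / η`, which vanishes at
  -- vertices; the potential is then at most the estimate of any fixed arm.
  have key : ∑ t ∈ Finset.Icc 1 T, ℓ t (J t)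
      ≤ ∑ t ∈ Finset.Icc 1 T,
          (G t + 4 * invRateStep η t * (∑ k, √(armProb η ℓ J t k) - 1))
        + (objective (η T) (cumEst η ℓ J T) (weights (η T) (cumEst η ℓ J T)) + 2 / η T) := by
    induction T, hT using Nat.le_induction with
    | base =>
      have h := hG 0
      rw [zero_add, objective_eq_of_mem (p := armProb η ℓ J 1) _ _ (weights_mem _ _)] at h
      simp only [Finset.Icc_self, Finset.sum_singleton, invRateStep, if_true, sub_zero]
      have e : (4 * ∑ k, √(armProb η ℓ J 1 k) - 2) / η 1
        = 4 * (η 1)⁻¹ * (∑ k, √(armProb η ℓ J 1 k) - 1) + 2 / η 1 := by ring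
      change ∑ k, armProb η ℓ J 1 k * 0 - (4 * ∑ k, √(armProb η ℓ J 1 k) - 2) / η 1 + _ - _ ≤ _ at h
      rw [e] at h
      simp only [mul_zero, Finset.sum_const_zero] at h
      linarith
    | succ T hT ih =>
      rw [Finset.sum_Icc_succ_top (by omega), Finset.sum_Icc_succ_top (by omega)]
      have h := hG T
      have hm : armProb η ℓ J (T + 1) ∈ stdSimplex ℝ (Fin K) := weights_mem _ _
      -- The distribution of round `T + 1` serves as a competitor in the problem with the old rate,
      -- so changing the rate costs only the penalty at that distribution.
      have h2 := objective_weights_le (η T) (cumEst η ℓ J T) hm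
      rw [objective_eq_of_mem _ _ hm] at h h2
      have e : invRateStep η (T + 1) = (η (T + 1))⁻¹ - (η T)⁻¹ := by
        rw [invRateStep, if_neg (by omega), Nat.add_sub_cancel]
      rw [e]
      simp only [div_eq_mul_inv] at h h2 ih ⊢
      linarith
  have h := objective_weights_le (η T) (cumEst η ℓ J T) (single_mem_stdSimplex ℝ i)
  have e : objective (η T) (cumEst η ℓ J T) (Pi.single i 1) = cumEst η ℓ J T i - 2 / η T := by
    rw [objective_eq_of_mem _ _ (single_mem_stdSimplex ℝ i)]
    have h1 : ∑ k, (Pi.single i 1 : Fin K → ℝ) k * cumEst η ℓ J T k = cumEst η ℓ J T i := by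
      rw [Finset.sum_eq_single i]
      · simp
      · intro j _ hj
        simp [hj]
      · simp
    have h2 : ∑ k, √((Pi.single i 1 : Fin K → ℝ) k) = 1 := by
      rw [Finset.sum_eq_single i]
      · simp
      · intro j _ hj
        simp [hj]
      · simp
    rw [h1, h2]
    ring
  rw [e] at h
  linarith

/-- Along every path the estimates stay in a range that depends on `η` and `b` only. -/
theorem exists_cumEst_bound {η b : ℕ → ℝ} (hη_pos : ∀ t, 1 ≤ t → 0 < η t) (t : ℕ) :
    ∃ B : ℝ, ∀ (ℓ : ℕ → Fin K → ℝ) (J : ℕ → Fin K),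
      (∀ s, 1 ≤ s → ∀ i, ℓ s i ∈ Set.Icc 0 (b s)) → ∀ i, cumEst η ℓ J t i ∈ Set.Icc 0 B := by
  induction t with
  | zero => exact ⟨0, fun ℓ J _ i => by simp [cumEst]⟩
  | succ t ih =>
    obtain ⟨B, hB⟩ := ih
    -- The increment is `ℓ / p = ℓ * (1 / √p) ^ 2`, and `inv_sqrt_weights_le` bounds `1 / √p`.
    refine ⟨B + |b (t + 1)| * (η (t + 1) / 2 * B + K) ^ 2, fun ℓ J hℓ i => ?_⟩
    have hη := hη_pos (t + 1) (by omega)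
    have hC := hB ℓ J hℓ
    have hpos := weights_pos hη (cumEst η ℓ J t) i
    have hinv := inv_sqrt_weights_le hη (fun k => (hC k).1) i
    have h1 := hℓ (t + 1) (by omega) i
    simp only [cumEst]
    set p := weights (η (t + 1)) (cumEst η ℓ J t) i
    have hB0 : 0 ≤ B := (hC i).1.trans (hC i).2
    have hM : 0 ≤ |b (t + 1)| * (η (t + 1) / 2 * B + K) ^ 2 := by positivity
    have h2 : ℓ (t + 1) i / p ≤ |b (t + 1)| * (η (t + 1) / 2 * B + K) ^ 2 := by
      have e : ℓ (t + 1) i / p = ℓ (t + 1) i * (1 / √p) ^ 2 := by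
        rw [div_pow, Real.sq_sqrt hpos.le]
        ring
      rw [e]
      have h3 : 1 / √p ≤ η (t + 1) / 2 * B + K := by
        refine hinv.trans ?_
        have := (hC i).2
        gcongr
      have h4 : ℓ (t + 1) i ≤ |b (t + 1)| := h1.2.trans (le_abs_self _)
      gcongr
    have h5 : 0 ≤ ℓ (t + 1) i / p := div_nonneg h1.1 hpos.le
    have h6 := hC i
    split_ifs
    · exact ⟨by linarith [h6.1], by linarith [h6.2]⟩
    · exact ⟨by linarith [h6.1], by linarith [h6.2]⟩

theorem exists_armProb_lower_bound {η b : ℕ → ℝ} (hη_pos : ∀ t, 1 ≤ t → 0 < η t) {t : ℕ}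
    (ht : 1 ≤ t) :
    ∃ M : ℝ, 0 ≤ M ∧ ∀ (ℓ : ℕ → Fin K → ℝ) (J : ℕ → Fin K),
      (∀ s, 1 ≤ s → ∀ i, ℓ s i ∈ Set.Icc 0 (b s)) → ∀ i, 1 / √(armProb η ℓ J t i) ≤ M := by
  obtain ⟨B, hB⟩ := exists_cumEst_bound (K := K) (b := b) hη_pos (t - 1)
  -- The absolute value is needed because `B` is known to be nonnegative only if some admissible
  -- path exists.
  refine ⟨η t / 2 * |B| + K, ?_, fun ℓ J hℓ i => ?_⟩
  · have := hη_pos t ht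
    positivity
  · have hη := hη_pos t ht
    refine (inv_sqrt_weights_le hη (fun k => (hB ℓ J hℓ k).1) i).trans ?_
    have := (hB ℓ J hℓ i).2.trans (le_abs_self B)
    gcongr

end Pathwise

/-! ### Measurability with respect to the past -/

section Measurability

variable {Ω : Type*} {K : ℕ} {ℓ : ℕ → Ω → Fin K → ℝ} {J : ℕ → Ω → Fin K}

theorem past_mono {s t : ℕ} (hst : s ≤ t) : past ℓ J s ≤ past ℓ J t :=
  biSup_mono fun r hr => by
    rw [Finset.mem_Ico] at hr ⊢
    omega

theorem measurable_loss_past {s t : ℕ} (hs : 1 ≤ s) (hst : s < t) :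
    Measurable[past ℓ J t] (ℓ s) := by
  rw [measurable_iff_comap_le]
  exact le_sup_left.trans (le_biSup (fun s => MeasurableSpace.comap (ℓ s) inferInstance
    ⊔ MeasurableSpace.comap (J s) inferInstance) (Finset.mem_Ico.2 ⟨hs, hst⟩))

theorem measurable_arm_past {s t : ℕ} (hs : 1 ≤ s) (hst : s < t) :
    Measurable[past ℓ J t] (J s) := by
  rw [measurable_iff_comap_le]
  exact le_sup_right.trans (le_biSup (fun s => MeasurableSpace.comap (ℓ s) inferInstance
    ⊔ MeasurableSpace.comap (J s) inferInstance) (Finset.mem_Ico.2 ⟨hs, hst⟩))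

theorem measurable_loss_apply_sup (t : ℕ) (i : Fin K) :
    Measurable[past ℓ J t ⊔ MeasurableSpace.comap (ℓ t) inferInstance] fun ω => ℓ t ω i :=
  (measurable_pi_apply i).comp ((comap_measurable (ℓ t)).mono le_sup_right le_rfl)

variable [NeZero K]

/-- The distribution of the arm of round `t`, as a random vector. -/
noncomputable abbrev randProb (η : ℕ → ℝ) (ℓ : ℕ → Ω → Fin K → ℝ) (J : ℕ → Ω → Fin K) (t : ℕ) (ω : Ω) :
    Fin K → ℝ :=
  armProb η (fun s => ℓ s ω) (fun s => J s ω) t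

theorem randProb_mem (η : ℕ → ℝ) (t : ℕ) (ω : Ω) :
    randProb η ℓ J t ω ∈ stdSimplex ℝ (Fin K) :=
  weights_mem _ _

theorem randProb_pos {η : ℕ → ℝ} (hη_pos : ∀ t, 1 ≤ t → 0 < η t) {t : ℕ} (ht : 1 ≤ t) (ω : Ω)
    (i : Fin K) : 0 < randProb η ℓ J t ω i :=
  weights_pos (hη_pos t ht) _ i

theorem abs_randProb_le_one (η : ℕ → ℝ) (t : ℕ) (ω : Ω) (i : Fin K) :
    |randProb η ℓ J t ω i| ≤ 1 := by
  rw [abs_of_nonneg ((randProb_mem η t ω).1 i)]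
  exact le_one_of_mem_stdSimplex (randProb_mem η t ω) i

theorem measurable_cumEst {η : ℕ → ℝ} (hη_pos : ∀ t, 1 ≤ t → 0 < η t) (t : ℕ) :
    Measurable[past ℓ J (t + 1)] fun ω => cumEst η (fun s => ℓ s ω) (fun s => J s ω) t := by
  induction t with
  | zero => exact measurable_const
  | succ t ih =>
    have ih' := ih.mono (past_mono (ℓ := ℓ) (J := J) (Nat.le_succ (t + 1))) le_rfl
    have hl : Measurable[past ℓ J (t + 1 + 1)] (ℓ (t + 1)) :=
      measurable_loss_past (by omega) (by omega)
    have hJ : Measurable[past ℓ J (t + 1 + 1)] (J (t + 1)) :=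
      measurable_arm_past (by omega) (by omega)
    simp only [cumEst]
    refine @measurable_pi_lambda _ _ _ (past ℓ J (t + 1 + 1)) _ _ fun i => ?_
    refine Measurable.add ((measurable_pi_apply i).comp ih') (Measurable.ite ?_ ?_ measurable_const)
    · exact hJ (measurableSet_singleton i)
    · exact Measurable.div ((measurable_pi_apply i).comp hl)
        ((measurable_weights (hη_pos (t + 1) (by omega)) i).comp ih')

theorem measurable_randProb {η : ℕ → ℝ} (hη_pos : ∀ t, 1 ≤ t → 0 < η t) {t : ℕ} (ht : 1 ≤ t) :
    Measurable[past ℓ J t] (randProb η ℓ J t) := by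
  obtain ⟨s, rfl⟩ : ∃ s, t = s + 1 := ⟨t - 1, by omega⟩
  exact (continuous_weights (hη_pos (s + 1) ht)).measurable.comp (measurable_cumEst hη_pos s)

theorem measurable_randProb_apply_sup {η : ℕ → ℝ} (hη_pos : ∀ t, 1 ≤ t → 0 < η t) {t : ℕ} (ht : 1 ≤ t)
    (i : Fin K) : Measurable[past ℓ J t ⊔ MeasurableSpace.comap (ℓ t) inferInstance]
      fun ω => randProb η ℓ J t ω i :=
  (measurable_pi_apply i).comp ((measurable_randProb hη_pos ht).mono le_sup_left le_rfl)

end Measurability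

/-! ### Averaging over the draws and passing to the regret -/

section Expectation

variable {Ω : Type*} [m0 : MeasurableSpace Ω] {μ : Measure Ω}
variable {K : ℕ} [NeZero K] {η b : ℕ → ℝ} {ℓ : ℕ → Ω → Fin K → ℝ} {J : ℕ → Ω → Fin K}

theorem past_le (hrun : IsRun μ η ℓ J) (t : ℕ) : past ℓ J t ≤ m0 :=
  iSup₂_le fun s _ => sup_le (hrun.measurable_loss s).comap_le (hrun.measurable_arm s).comap_le

theorem past_sup_le (hrun : IsRun μ η ℓ J) (t : ℕ) :
    past ℓ J t ⊔ MeasurableSpace.comap (ℓ t) inferInstance ≤ m0 :=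
  sup_le (past_le hrun t) (hrun.measurable_loss t).comap_le

theorem measurable_loss_apply (hrun : IsRun μ η ℓ J) (t : ℕ) (i : Fin K) :
    Measurable fun ω => ℓ t ω i :=
  (measurable_pi_apply i).comp (hrun.measurable_loss t)

variable [IsProbabilityMeasure μ]

theorem integrable_of_abs_le {f : Ω → ℝ} (hf : Measurable f) {M : ℝ} (hM : ∀ ω, |f ω| ≤ M) :
    Integrable f μ :=
  Integrable.of_bound hf.aestronglyMeasurable M (Filter.Eventually.of_forall hM)

/-- The pull-out property followed by the tower property. It is applied both to the sampling rule
and to the conditional loss differences. -/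
theorem integral_mul_of_condExp_ae_eq {m : MeasurableSpace Ω} (hm : m ≤ m0)
    {f g h : Ω → ℝ} (hf : Measurable[m] f) {M : ℝ} (hM : ∀ ω, |f ω| ≤ M) (hg : Integrable g μ)
    (hgh : μ[g | m] =ᵐ[μ] h) : ∫ ω, f ω * g ω ∂μ = ∫ ω, f ω * h ω ∂μ := by
  have hfg : Integrable (f * g) μ :=
    hg.bdd_mul (hf.mono hm le_rfl).aestronglyMeasurable (Filter.Eventually.of_forall hM)
  have h1 : μ[f * g | m] =ᵐ[μ] f * μ[g | m] :=
    condExp_mul_of_stronglyMeasurable_left hf.stronglyMeasurable hfg hg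
  calc ∫ ω, f ω * g ω ∂μ = ∫ ω, (μ[f * g | m]) ω ∂μ := (integral_condExp hm).symm
    _ = ∫ ω, f ω * h ω ∂μ := by
      refine integral_congr_ae ?_
      filter_upwards [h1, hgh] with ω h1 h2
      rw [h1, Pi.mul_apply, h2]

theorem integrable_loss (hrun : IsRun μ η ℓ J)
    (hℓ : ∀ t, 1 ≤ t → ∀ ω i, ℓ t ω i ∈ Set.Icc 0 (b t)) {t : ℕ} (ht : 1 ≤ t) (i : Fin K) :
    Integrable (fun ω => ℓ t ω i) μ :=
  integrable_of_abs_le (measurable_loss_apply hrun t i) fun ω => by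
    rw [abs_of_nonneg (hℓ t ht ω i).1]
    exact (hℓ t ht ω i).2

theorem integrable_randProb (hrun : IsRun μ η ℓ J) (hη_pos : ∀ t, 1 ≤ t → 0 < η t) {t : ℕ}
    (ht : 1 ≤ t) (i : Fin K) : Integrable (fun ω => randProb η ℓ J t ω i) μ :=
  integrable_of_abs_le ((measurable_pi_apply i).comp
    ((measurable_randProb hη_pos ht).mono (past_le hrun t) le_rfl)) fun ω =>
      abs_randProb_le_one η t ω i

theorem integrable_sqrt_randProb (hrun : IsRun μ η ℓ J) (hη_pos : ∀ t, 1 ≤ t → 0 < η t) {t : ℕ}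
    (ht : 1 ≤ t) (i : Fin K) : Integrable (fun ω => √(randProb η ℓ J t ω i)) μ :=
  integrable_of_abs_le ((measurable_pi_apply i).comp
    ((measurable_randProb hη_pos ht).mono (past_le hrun t) le_rfl)).sqrt fun ω => by
      rw [abs_of_nonneg (Real.sqrt_nonneg _)]
      exact Real.sqrt_le_one.2 (le_one_of_mem_stdSimplex (randProb_mem η t ω) i)

/-- Averaging over the draw of the arm: `G i` is known before the arm of round `t` is drawn. -/
theorem integral_arm (hrun : IsRun μ η ℓ J) (hη_pos : ∀ t, 1 ≤ t → 0 < η t) {t : ℕ} (ht : 1 ≤ t)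
    {G : Fin K → Ω → ℝ}
    (hG : ∀ i, Measurable[past ℓ J t ⊔ MeasurableSpace.comap (ℓ t) inferInstance] (G i))
    {M : ℝ} (hM : ∀ i ω, |G i ω| ≤ M) :
    Integrable (fun ω => G (J t ω) ω) μ ∧
      Integrable (fun ω => ∑ i, randProb η ℓ J t ω i * G i ω) μ ∧
      ∫ ω, G (J t ω) ω ∂μ = ∫ ω, ∑ i, randProb η ℓ J t ω i * G i ω ∂μ := by
  have hm := past_sup_le hrun t
  have hGm : ∀ i, Measurable (G i) := fun i => (hG i).mono hm le_rfl
  have e : ∀ ω, G (J t ω) ω = ∑ i, G i ω * (J t ⁻¹' {i}).indicator (fun _ => (1 : ℝ)) ω := by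
    intro ω
    rw [Finset.sum_eq_single (J t ω)]
    · simp
    · intro i _ hi
      simp [hi.symm]
    · simp
  have hind : ∀ i, Integrable ((J t ⁻¹' {i}).indicator (fun _ => (1 : ℝ))) μ := fun i =>
    (integrable_const 1).indicator (hrun.measurable_arm t (measurableSet_singleton i))
  have hint : ∀ i, Integrable (fun ω => G i ω * (J t ⁻¹' {i}).indicator (fun _ => (1 : ℝ)) ω) μ :=
    fun i => (hind i).bdd_mul (hGm i).aestronglyMeasurable (Filter.Eventually.of_forall (hM i))
  have hint' : ∀ i, Integrable (fun ω => randProb η ℓ J t ω i * G i ω) μ := fun i => by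
    refine (integrable_of_abs_le (hGm i) (hM i)).bdd_mul (c := 1)
      (integrable_randProb hrun hη_pos ht i).aestronglyMeasurable
      (Filter.Eventually.of_forall fun ω => abs_randProb_le_one η t ω i)
  refine ⟨?_, integrable_finsetSum _ fun i _ => hint' i, ?_⟩
  · simp only [e]
    exact integrable_finsetSum _ fun i _ => hint i
  · simp only [e]
    rw [integral_finsetSum _ fun i _ => hint i, integral_finsetSum _ fun i _ => hint' i]
    refine Finset.sum_congr rfl fun i _ => ?_
    rw [integral_mul_of_condExp_ae_eq hm (hG i) (hM i) (hind i) (hrun.sampling t ht i)]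
    exact integral_congr_ae (Filter.Eventually.of_forall fun ω => mul_comm _ _)

theorem integral_loss_arm (hrun : IsRun μ η ℓ J) (hη_pos : ∀ t, 1 ≤ t → 0 < η t)
    (hℓ : ∀ t, 1 ≤ t → ∀ ω i, ℓ t ω i ∈ Set.Icc 0 (b t)) {t : ℕ} (ht : 1 ≤ t) :
    Integrable (fun ω => ℓ t ω (J t ω)) μ ∧
      Integrable (fun ω => ∑ i, randProb η ℓ J t ω i * ℓ t ω i) μ ∧
      ∫ ω, ℓ t ω (J t ω) ∂μ = ∫ ω, ∑ i, randProb η ℓ J t ω i * ℓ t ω i ∂μ :=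
  integral_arm hrun hη_pos ht (G := fun i ω => ℓ t ω i) (M := b t)
    (fun i => measurable_loss_apply_sup t i) fun i ω => by
      rw [abs_of_nonneg (hℓ t ht ω i).1]
      exact (hℓ t ht ω i).2

/-- The importance-weighted estimates are unbiased. -/
theorem integral_cumEst (hrun : IsRun μ η ℓ J) (hη_pos : ∀ t, 1 ≤ t → 0 < η t)
    (hℓ : ∀ t, 1 ≤ t → ∀ ω i, ℓ t ω i ∈ Set.Icc 0 (b t)) (T : ℕ) (i : Fin K) :
    Integrable (fun ω => cumEst η (fun s => ℓ s ω) (fun s => J s ω) T i) μ ∧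
      ∫ ω, cumEst η (fun s => ℓ s ω) (fun s => J s ω) T i ∂μ
        = ∫ ω, ∑ t ∈ Finset.Icc 1 T, ℓ t ω i ∂μ := by
  induction T with
  | zero => simp [cumEst]
  | succ T ih =>
    have ht : 1 ≤ T + 1 := by omega
    obtain ⟨M, hM0, hM⟩ := exists_armProb_lower_bound (K := K) (b := b) hη_pos ht
    obtain ⟨h1, -, h2⟩ := integral_arm hrun hη_pos ht
      (G := fun k ω => if k = i then ℓ (T + 1) ω i / randProb η ℓ J (T + 1) ω i else 0)
      (M := |b (T + 1)| * M ^ 2)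
      (fun k => by
        split_ifs
        · exact (measurable_loss_apply_sup _ i).div (measurable_randProb_apply_sup hη_pos ht i)
        · exact measurable_const)
      (fun k ω => by
        split_ifs
        · have hp := randProb_pos (ℓ := ℓ) (J := J) hη_pos ht ω i
          have hm := hM (fun s => ℓ s ω) (fun s => J s ω) (fun s hs k => hℓ s hs ω k) i
          have hl := hℓ (T + 1) ht ω i
          rw [abs_of_nonneg (div_nonneg hl.1 hp.le)]
          have e : ℓ (T + 1) ω i / randProb η ℓ J (T + 1) ω i
              = ℓ (T + 1) ω i * (1 / √(randProb η ℓ J (T + 1) ω i)) ^ 2 := by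
            rw [div_pow, Real.sq_sqrt hp.le]
            ring
          rw [e]
          have := hl.2.trans (le_abs_self _)
          gcongr
        · rw [abs_zero]
          positivity)
    -- The probability of drawing arm `i` cancels the importance weight.
    have e : ∀ ω, ∑ k, randProb η ℓ J (T + 1) ω k *
        (if k = i then ℓ (T + 1) ω i / randProb η ℓ J (T + 1) ω i else 0) = ℓ (T + 1) ω i := by
      intro ω
      have hp := randProb_pos (ℓ := ℓ) (J := J) hη_pos ht ω i
      rw [Finset.sum_eq_single i]
      · rw [if_pos rfl, mul_div_cancel₀ _ hp.ne']
      · intro k _ hk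
        rw [if_neg hk, mul_zero]
      · simp
    simp only [e] at h2
    have hsum : Integrable (fun ω => ∑ t ∈ Finset.Icc 1 T, ℓ t ω i) μ :=
      integrable_finsetSum _ fun t ht => integrable_loss hrun hℓ (Finset.mem_Icc.1 ht).1 i
    refine ⟨ih.1.add h1, ?_⟩
    simp only [Finset.sum_Icc_succ_top ht]
    rw [integral_add hsum (integrable_loss hrun hℓ ht i), ← ih.2, ← h2]
    exact integral_add ih.1 h1

/-- Regret against a fixed arm in terms of bounds `G t j p` for the stability of round `t` when
arm `j` is drawn from `p`. -/
theorem regret_le (hrun : IsRun μ η ℓ J) (hη_pos : ∀ t, 1 ≤ t → 0 < η t)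
    (hℓ : ∀ t, 1 ≤ t → ∀ ω i, ℓ t ω i ∈ Set.Icc 0 (b t)) {T : ℕ} (hT : 1 ≤ T) (i : Fin K)
    (G : ℕ → Fin K → (Fin K → ℝ) → ℝ) (hGm : ∀ t k, Measurable (G t k))
    (M : ℕ → ℝ)
    (hGb : ∀ t k, ∀ p ∈ stdSimplex ℝ (Fin K), 0 < p k → |G t k p| ≤ M t * (1 / √(p k)))
    (hG : ∀ t, 1 ≤ t → t ≤ T → ∀ (C x : Fin K → ℝ), (∀ k, x k ∈ Set.Icc 0 (b t)) → ∀ j,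
      objective (η t) C (weights (η t) C) + x j
        - objective (η t) (fun k => C k + if j = k then x k / weights (η t) C k else 0)
          (weights (η t) fun k => C k + if j = k then x k / weights (η t) C k else 0)
        ≤ G t j (weights (η t) C))
    (H : ℕ → (Fin K → ℝ) → ℝ)
    (hHi : ∀ t, 1 ≤ t → Integrable (fun ω => H t (randProb η ℓ J t ω)) μ)
    (hH : ∀ t, 1 ≤ t → t ≤ T → ∀ p ∈ stdSimplex ℝ (Fin K), (∀ k, 0 < p k) →
      ∑ k, p k * G t k p + 4 * invRateStep η t * (∑ k, √(p k) - 1) ≤ H t p) :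
    (∫ ω, ∑ t ∈ Finset.Icc 1 T, ℓ t ω (J t ω) ∂μ) - ∫ ω, ∑ t ∈ Finset.Icc 1 T, ℓ t ω i ∂μ
      ≤ ∑ t ∈ Finset.Icc 1 T, ∫ ω, H t (randProb η ℓ J t ω) ∂μ := by
  obtain ⟨hCi, hCe⟩ := integral_cumEst hrun hη_pos hℓ T i
  have hGint : ∀ t, 1 ≤ t →
      Integrable (fun ω => G t (J t ω) (randProb η ℓ J t ω)) μ ∧
      Integrable (fun ω => ∑ k, randProb η ℓ J t ω k * G t k (randProb η ℓ J t ω)) μ ∧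
      ∫ ω, G t (J t ω) (randProb η ℓ J t ω) ∂μ
        = ∫ ω, ∑ k, randProb η ℓ J t ω k * G t k (randProb η ℓ J t ω) ∂μ := by
    intro t ht
    obtain ⟨B, hB0, hB⟩ := exists_armProb_lower_bound (K := K) (b := b) hη_pos ht
    refine integral_arm hrun hη_pos ht (G := fun k ω => G t k (randProb η ℓ J t ω))
      (M := |M t| * B) (fun k => ?_) fun k ω => ?_
    · exact (hGm t k).comp ((measurable_randProb hη_pos ht).mono le_sup_left le_rfl)
    · refine (hGb t k _ (randProb_mem η t ω) (randProb_pos hη_pos ht ω k)).trans ?_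
      have hb := hB (fun s => ℓ s ω) (fun s => J s ω) (fun s hs k => hℓ s hs ω k) k
      have : M t ≤ |M t| := le_abs_self _
      gcongr
  have hpen : ∀ t, 1 ≤ t → Integrable
      (fun ω => 4 * invRateStep η t * (∑ k, √(randProb η ℓ J t ω k) - 1)) μ := fun t ht =>
    ((integrable_finsetSum _ fun k _ => integrable_sqrt_randProb hrun hη_pos ht k).sub
      (integrable_const 1)).const_mul _
  have hterm : ∀ t ∈ Finset.Icc 1 T, Integrable (fun ω => G t (J t ω) (randProb η ℓ J t ω)
      + 4 * invRateStep η t * (∑ k, √(randProb η ℓ J t ω k) - 1)) μ := fun t ht =>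
    (hGint t (Finset.mem_Icc.1 ht).1).1.add (hpen t (Finset.mem_Icc.1 ht).1)
  have hsumi : Integrable (fun ω => ∑ t ∈ Finset.Icc 1 T,
      (G t (J t ω) (randProb η ℓ J t ω)
        + 4 * invRateStep η t * (∑ k, √(randProb η ℓ J t ω k) - 1))) μ :=
    integrable_finsetSum _ hterm
  have h1 : ∫ ω, ∑ t ∈ Finset.Icc 1 T, ℓ t ω (J t ω) ∂μ
      ≤ ∫ ω, (∑ t ∈ Finset.Icc 1 T, (G t (J t ω) (randProb η ℓ J t ω)
        + 4 * invRateStep η t * (∑ k, √(randProb η ℓ J t ω k) - 1))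
        + cumEst η (fun s => ℓ s ω) (fun s => J s ω) T i) ∂μ := by
    refine integral_mono (integrable_finsetSum _ fun t ht =>
      (integral_loss_arm hrun hη_pos hℓ (Finset.mem_Icc.1 ht).1).1) (hsumi.add hCi) fun ω => ?_
    set S : ℕ → ℝ := fun t => objective (η t) (cumEst η (fun s => ℓ s ω) (fun s => J s ω) (t - 1))
        (randProb η ℓ J t ω) + ℓ t ω (J t ω)
        - objective (η t) (cumEst η (fun s => ℓ s ω) (fun s => J s ω) t)
          (weights (η t) (cumEst η (fun s => ℓ s ω) (fun s => J s ω) t)) with hS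
    have h := sum_loss_le η (fun s => ℓ s ω) (fun s => J s ω) S (fun t => le_rfl) T hT i
    refine h.trans ?_
    gcongr with t ht
    obtain ⟨ht1, htT⟩ := Finset.mem_Icc.1 ht
    obtain ⟨s, rfl⟩ : ∃ s, t = s + 1 := ⟨t - 1, by omega⟩
    exact hG (s + 1) ht1 htT _ (ℓ (s + 1) ω) (fun k => hℓ (s + 1) ht1 ω k) (J (s + 1) ω)
  rw [integral_add hsumi hCi, hCe, integral_finsetSum _ hterm] at h1
  have h2 : ∑ t ∈ Finset.Icc 1 T, ∫ ω, (G t (J t ω) (randProb η ℓ J t ω)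
        + 4 * invRateStep η t * (∑ k, √(randProb η ℓ J t ω k) - 1)) ∂μ
      ≤ ∑ t ∈ Finset.Icc 1 T, ∫ ω, H t (randProb η ℓ J t ω) ∂μ := by
    refine Finset.sum_le_sum fun t ht => ?_
    obtain ⟨ht1, htT⟩ := Finset.mem_Icc.1 ht
    rw [integral_add (hGint t ht1).1 (hpen t ht1), (hGint t ht1).2.2,
      ← integral_add (hGint t ht1).2.1 (hpen t ht1)]
    exact integral_mono ((hGint t ht1).2.1.add (hpen t ht1)) (hHi t ht1) fun ω =>
      hH t ht1 htT _ (randProb_mem η t ω) fun k => randProb_pos hη_pos ht1 ω k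
  linarith

end Expectation

/-! ### Elementary inequalities on the simplex -/

section SimplexInequalities

variable {K : ℕ} {p : Fin K → ℝ}

theorem sum_sqrt_le_sqrt_card (hp : p ∈ stdSimplex ℝ (Fin K)) : ∑ i, √(p i) ≤ √(K : ℝ) := by
  apply Real.le_sqrt_of_sq_le
  have h := sq_sum_le_card_mul_sum_sq (s := Finset.univ) (f := fun i => √(p i))
  have e : ∑ i, √(p i) ^ 2 = 1 := by
    rw [← hp.2]
    exact Finset.sum_congr rfl fun i _ => Real.sq_sqrt (hp.1 i)
  simpa [e] using h

theorem sum_erase_eq (hp : p ∈ stdSimplex ℝ (Fin K)) (j : Fin K) :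
    ∑ i ∈ Finset.univ.erase j, p i = 1 - p j := by
  rw [← hp.2, ← Finset.add_sum_erase _ _ (Finset.mem_univ j)]
  ring

/-- From `(√(p j) - 1)² ≥ 0` one gets `√(p j) - 1 ≤ -(1 - p j) / 2`, and `1 - p j` is the mass of
the other arms. This removes the best arm from the penalty. -/
theorem sum_sqrt_sub_one_le (hp : p ∈ stdSimplex ℝ (Fin K)) (j : Fin K) :
    ∑ i, √(p i) - 1 ≤ ∑ i ∈ Finset.univ.erase j, (√(p i) - p i / 2) := by
  rw [Finset.sum_sub_distrib, ← Finset.sum_div, sum_erase_eq hp j,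
    ← Finset.add_sum_erase _ _ (Finset.mem_univ j)]
  have h1 := Real.sq_sqrt (hp.1 j)
  nlinarith [sq_nonneg (√(p j) - 1)]

theorem mul_div_sqrt_self {x : ℝ} (hx : 0 < x) (a : ℝ) : x * (a / √x) = a * √x := by
  have h := Real.sq_sqrt hx.le
  have h0 : 0 < √x := Real.sqrt_pos.2 hx
  nth_rw 1 [← h]
  field_simp

end SimplexInequalities

/-- Stability and penalty of one suboptimal arm; `x` is the square root of its probability. -/
theorem stability_add_penalty_le {η b : ℕ → ℝ} {t : ℕ} (hη : 0 < η t) {x : ℝ}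
    (hx0 : 0 ≤ x) (hx1 : x ≤ 1) :
    η t * b t ^ 2 * (x / 2 + 5 / 4 * x ^ 2) + 4 * invRateStep η t * (x - x ^ 2 / 2)
      ≤ (7 / 4 * η t * b t ^ 2 + stepConst η b t * invRateStep η t) * x := by
  have hN : 0 ≤ η t * b t ^ 2 := by positivity
  have hx2 : x ^ 2 ≤ x := by nlinarith
  -- The coefficient of `x²` is `5/4 η b² - 2 δ`, with `δ` the step of the inverse rate. If it is
  -- nonnegative, `x² ≤ x` merges it into the linear term, leaving `2 δ`; otherwise it is dropped,
  -- leaving `4 δ`.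
  unfold stepConst
  split_ifs with h
  · have : (5 * η t / 4 * b t ^ 2 - 2 * invRateStep η t) * x ^ 2
        ≤ (5 * η t / 4 * b t ^ 2 - 2 * invRateStep η t) * x :=
      mul_le_mul_of_nonneg_left hx2 (sub_nonneg.2 h)
    linarith
  · have : (5 * η t / 4 * b t ^ 2 - 2 * invRateStep η t) * x ^ 2 ≤ 0 :=
      mul_nonpos_of_nonpos_of_nonneg (by linarith) (sq_nonneg x)
    have : 0 ≤ η t * b t ^ 2 * x := by positivity
    linarith

/-! ### The two regret bounds -/

section Regret

variable {Ω : Type*} [MeasurableSpace Ω] {μ : Measure Ω} [IsProbabilityMeasure μ]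
  {K : ℕ} [NeZero K] {η b : ℕ → ℝ} {ℓ : ℕ → Ω → Fin K → ℝ} {J : ℕ → Ω → Fin K}

theorem regret_le_adversarial (hrun : IsRun μ η ℓ J) (hη_pos : ∀ t, 1 ≤ t → 0 < η t)
    (hη_anti : ∀ s t, 1 ≤ s → s ≤ t → η t ≤ η s)
    (hℓ : ∀ t, 1 ≤ t → ∀ ω i, ℓ t ω i ∈ Set.Icc 0 (b t)) {T : ℕ} (hT : 1 ≤ T) (i : Fin K) :
    (∫ ω, ∑ t ∈ Finset.Icc 1 T, ℓ t ω (J t ω) ∂μ) - ∫ ω, ∑ t ∈ Finset.Icc 1 T, ℓ t ω i ∂μ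
      ≤ √(K : ℝ) * (∑ t ∈ Finset.Icc 1 T, η t / 2 * b t ^ 2 + 4 / η T) := by
  refine (regret_le hrun hη_pos hℓ hT i (fun t k p => η t / 2 * b t ^ 2 / √(p k))
    (fun t k => by fun_prop) (fun t => |η t / 2 * b t ^ 2|) ?_ ?_
    (fun t _ => √(K : ℝ) * (η t / 2 * b t ^ 2) + 4 * √(K : ℝ) * invRateStep η t)
    (fun t _ => integrable_const _) ?_).trans (le_of_eq ?_)
  · intro t k p _ _
    rw [abs_div, abs_of_nonneg (Real.sqrt_nonneg _), mul_one_div]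
  · intro t ht _ C x hx j
    exact stability_estimate_le (hη_pos t ht) C hx j
  · intro t ht _ p hp hpos
    have h1 := sum_sqrt_le_sqrt_card hp
    have h2 := invRateStep_nonneg hη_pos hη_anti ht
    have e : ∑ k, p k * (η t / 2 * b t ^ 2 / √(p k)) = η t / 2 * b t ^ 2 * ∑ k, √(p k) := by
      rw [Finset.mul_sum]
      exact Finset.sum_congr rfl fun k _ => mul_div_sqrt_self (hpos k) _
    rw [e]
    have h3 : η t / 2 * b t ^ 2 * ∑ k, √(p k) ≤ η t / 2 * b t ^ 2 * √(K : ℝ) := by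
      have := hη_pos t ht
      gcongr
    have h4 : 4 * invRateStep η t * (∑ k, √(p k) - 1) ≤ 4 * invRateStep η t * √(K : ℝ) := by
      gcongr
      linarith
    linarith
  · simp only [integral_const, probReal_univ, one_smul]
    rw [Finset.sum_add_distrib, ← Finset.mul_sum, ← Finset.mul_sum, sum_invRateStep η T hT]
    ring

/-- The bound on which the self-bounding argument rests: only suboptimal arms contribute, apart
from the rounds in which the learning rate is large. -/
theorem regret_le_sum_sqrt (hrun : IsRun μ η ℓ J) (hη_pos : ∀ t, 1 ≤ t → 0 < η t)
    (hη_anti : ∀ s t, 1 ≤ s → s ≤ t → η t ≤ η s)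
    (hℓ : ∀ t, 1 ≤ t → ∀ ω i, ℓ t ω i ∈ Set.Icc 0 (b t)) {T : ℕ} (hT : 1 ≤ T) (i : Fin K)
    {T₀ : ℕ} (hT₀ : ∀ t, T₀ < t → t ≤ T → η t * b t ≤ 1 / 4) :
    (∫ ω, ∑ t ∈ Finset.Icc 1 T, ℓ t ω (J t ω) ∂μ) - ∫ ω, ∑ t ∈ Finset.Icc 1 T, ℓ t ω i ∂μ
      ≤ ∑ t ∈ Finset.Icc 1 T, ∫ ω, (∑ k ∈ Finset.univ.erase i,
          (7 / 4 * η t * b t ^ 2 + stepConst η b t * invRateStep η t) * √(randProb η ℓ J t ω k)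
          + if t ≤ T₀ then η t / 2 * b t ^ 2 else 0) ∂μ := by
  refine regret_le hrun hη_pos hℓ hT i
    -- The shifted estimate is used only when the best arm is drawn in a round with small rate.
    (fun t k p => if t ≤ T₀ ∨ k ≠ i then η t / 2 * b t ^ 2 / √(p k) else
      η t / 2 * b t ^ 2 * (1 - p k) / √(p k)
        + ∑ j ∈ Finset.univ.erase k, 4 / 7 * η t * b t ^ 2 * p j)
    (fun t k => ?_) (fun t => 2 * |η t * b t ^ 2|) ?_ ?_
    (fun t p => ∑ k ∈ Finset.univ.erase i,
        (7 / 4 * η t * b t ^ 2 + stepConst η b t * invRateStep η t) * √(p k)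
      + if t ≤ T₀ then η t / 2 * b t ^ 2 else 0)
    (fun t ht => ?_) ?_
  · split_ifs <;> fun_prop
  · intro t k p hp hpk
    have ha : 0 < √(p k) := Real.sqrt_pos.2 hpk
    have ha1 : √(p k) ≤ 1 := Real.sqrt_le_one.2 (le_one_of_mem_stdSimplex hp k)
    have hinv : 1 ≤ 1 / √(p k) := by rw [le_div_iff₀ ha]; linarith
    have hN := abs_nonneg (η t * b t ^ 2)
    have hle := le_one_of_mem_stdSimplex hp k
    split_ifs
    · have e : η t / 2 * b t ^ 2 / √(p k) = η t * b t ^ 2 * (1 / 2 * (1 / √(p k))) := by ring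
      rw [e, abs_mul, abs_of_nonneg (by positivity : 0 ≤ 1 / 2 * (1 / √(p k)))]
      nlinarith
    · have e : η t / 2 * b t ^ 2 * (1 - p k) / √(p k)
          + ∑ j ∈ Finset.univ.erase k, 4 / 7 * η t * b t ^ 2 * p j
          = η t * b t ^ 2 * ((1 - p k) * (1 / 2 * (1 / √(p k)) + 4 / 7)) := by
        rw [← Finset.mul_sum, sum_erase_eq hp]
        ring
      have h0 : 0 ≤ (1 - p k) * (1 / 2 * (1 / √(p k)) + 4 / 7) :=
        mul_nonneg (by linarith) (by positivity)
      have h1 : (1 - p k) * (1 / 2 * (1 / √(p k)) + 4 / 7) ≤ 2 * (1 / √(p k)) := by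
        have : (1 - p k) * (1 / 2 * (1 / √(p k)) + 4 / 7) ≤ 1 * (1 / 2 * (1 / √(p k)) + 4 / 7) :=
          mul_le_mul_of_nonneg_right (by linarith) (by positivity)
        linarith
      rw [e, abs_mul, abs_of_nonneg h0]
      nlinarith
  · intro t ht htT C x hx j
    split_ifs with h
    · exact stability_estimate_le (hη_pos t ht) C hx j
    · push Not at h
      exact stability_estimate_best_le (hη_pos t ht) C hx (hT₀ t h.1 htT) j
  · exact (integrable_finsetSum _ fun k _ =>
      (integrable_sqrt_randProb hrun hη_pos ht k).const_mul _).add (integrable_const _)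
  · intro t ht _ p hp hpos
    have hη := hη_pos t ht
    have hN : 0 ≤ η t * b t ^ 2 := by positivity
    have hδ := invRateStep_nonneg hη_pos hη_anti ht
    have hpen := mul_le_mul_of_nonneg_left (sum_sqrt_sub_one_le hp i)
      (by positivity : 0 ≤ 4 * invRateStep η t)
    have hs1 : √(p i) ≤ 1 := Real.sqrt_le_one.2 (le_one_of_mem_stdSimplex hp i)
    have hp1 := le_one_of_mem_stdSimplex hp i
    -- In late rounds the best arm contributes at most `(1/2 + 4/7) η b² (1 - p i)`, which `5/4`
    -- covers with room to spare. In early rounds it contributes at most `η b² / 2`.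
    have hstab : ∑ k, p k * (if t ≤ T₀ ∨ k ≠ i then η t / 2 * b t ^ 2 / √(p k) else
          η t / 2 * b t ^ 2 * (1 - p k) / √(p k)
            + ∑ j ∈ Finset.univ.erase k, 4 / 7 * η t * b t ^ 2 * p j)
        ≤ ∑ k ∈ Finset.univ.erase i, η t * b t ^ 2 * (√(p k) / 2 + 5 / 4 * p k)
          + if t ≤ T₀ then η t / 2 * b t ^ 2 else 0 := by
      rw [← Finset.add_sum_erase _ _ (Finset.mem_univ i)]
      have e : ∑ k ∈ Finset.univ.erase i, p k * (if t ≤ T₀ ∨ k ≠ i then η t / 2 * b t ^ 2 / √(p k)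
          else η t / 2 * b t ^ 2 * (1 - p k) / √(p k)
            + ∑ j ∈ Finset.univ.erase k, 4 / 7 * η t * b t ^ 2 * p j)
          = ∑ k ∈ Finset.univ.erase i, η t * b t ^ 2 * (√(p k) / 2) := by
        refine Finset.sum_congr rfl fun k hk => ?_
        rw [if_pos (Or.inr (Finset.ne_of_mem_erase hk)), mul_div_sqrt_self (hpos k)]
        ring
      have e2 : ∑ k ∈ Finset.univ.erase i, η t * b t ^ 2 * (√(p k) / 2 + 5 / 4 * p k)
          = ∑ k ∈ Finset.univ.erase i, η t * b t ^ 2 * (√(p k) / 2)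
            + 5 / 4 * (η t * b t ^ 2) * (1 - p i) := by
        rw [← sum_erase_eq hp, Finset.mul_sum, ← Finset.sum_add_distrib]
        exact Finset.sum_congr rfl fun k _ => by ring
      rw [e, e2]
      have h0 : 0 ≤ 5 / 4 * (η t * b t ^ 2) * (1 - p i) :=
        mul_nonneg (by positivity) (by linarith)
      by_cases h : t ≤ T₀
      · rw [if_pos (Or.inl h), if_pos h, mul_div_sqrt_self (hpos i)]
        nlinarith
      · rw [if_neg (by simpa using h), if_neg h, mul_add, mul_div_sqrt_self (hpos i),
          ← Finset.mul_sum, sum_erase_eq hp]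
        have hq : 0 ≤ η t * b t ^ 2 * (1 - p i) := mul_nonneg hN (by linarith)
        have h1 : η t * b t ^ 2 * (1 - p i) * √(p i) ≤ η t * b t ^ 2 * (1 - p i) * 1 :=
          mul_le_mul_of_nonneg_left hs1 hq
        have h2 : η t * b t ^ 2 * (1 - p i) * p i ≤ η t * b t ^ 2 * (1 - p i) * 1 :=
          mul_le_mul_of_nonneg_left hp1 hq
        linarith
    have hsum : ∑ k ∈ Finset.univ.erase i, η t * b t ^ 2 * (√(p k) / 2 + 5 / 4 * p k)
        + 4 * invRateStep η t * ∑ k ∈ Finset.univ.erase i, (√(p k) - p k / 2)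
        ≤ ∑ k ∈ Finset.univ.erase i,
          (7 / 4 * η t * b t ^ 2 + stepConst η b t * invRateStep η t) * √(p k) := by
      rw [Finset.mul_sum, ← Finset.sum_add_distrib]
      refine Finset.sum_le_sum fun k _ => ?_
      have h := stability_add_penalty_le (b := b) hη (Real.sqrt_nonneg (p k))
        (Real.sqrt_le_one.2 (le_one_of_mem_stdSimplex hp k))
      rwa [Real.sq_sqrt (hp.1 k)] at h
    linarith

theorem integral_loss_sub (hrun : IsRun μ η ℓ J) {D : Fin K → Fin K → ℝ}
    (hD : IsStochConstrained μ b D ℓ J) {t : ℕ} (ht : 1 ≤ t) (i j : Fin K) :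
    ∫ ω, (ℓ t ω i - ℓ t ω j) ∂μ = b t * D i j := by
  rw [← integral_condExp (past_le hrun t), integral_congr_ae (hD t ht i j)]
  simp

/-- Expected differences in round `1` are additive, so `b 1 > 0` gives `D i iStar = D i 0 - D iStar
0`; a zero gap makes `D iStar 0` the minimum. -/
theorem gap_eq (hrun : IsRun μ η ℓ J) (hℓ : ∀ t, 1 ≤ t → ∀ ω i, ℓ t ω i ∈ Set.Icc 0 (b t))
    {D : Fin K → Fin K → ℝ} (hb : 0 < b 1) (hD : IsStochConstrained μ b D ℓ J) {iStar : Fin K}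
    (hgap : gap D iStar = 0) (i : Fin K) : gap D i = D i iStar := by
  have h1 := integral_loss_sub hrun hD le_rfl i iStar
  have h2 := integral_loss_sub hrun hD le_rfl i 0
  have h3 := integral_loss_sub hrun hD le_rfl iStar 0
  have hi := fun k => integrable_loss hrun hℓ le_rfl k
  rw [integral_sub (hi _) (hi _)] at h1 h2 h3
  have h4 : b 1 * D i iStar = b 1 * (D i 0 - D iStar 0) := by linarith
  have h5 := mul_left_cancel₀ hb.ne' h4
  unfold gap at hgap ⊢
  linarith

theorem gap_nonneg (D : Fin K → Fin K → ℝ) (i : Fin K) : 0 ≤ gap D i :=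
  sub_nonneg.2 (ciInf_le (Set.finite_range _).bddBelow i)

/-- In the stochastically constrained regime the best arm has the smallest expected loss. -/
theorem pseudoRegret_eq_best (hrun : IsRun μ η ℓ J)
    (hℓ : ∀ t, 1 ≤ t → ∀ ω i, ℓ t ω i ∈ Set.Icc 0 (b t))
    {D : Fin K → Fin K → ℝ} (hb : ∀ t, 1 ≤ t → 0 < b t) (hD : IsStochConstrained μ b D ℓ J)
    {iStar : Fin K} (hgap : gap D iStar = 0) (T : ℕ) :
    pseudoRegret μ ℓ J T = (∫ ω, ∑ t ∈ Finset.Icc 1 T, ℓ t ω (J t ω) ∂μ)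
      - ∫ ω, ∑ t ∈ Finset.Icc 1 T, ℓ t ω iStar ∂μ := by
  unfold pseudoRegret
  congr 1
  refine le_antisymm (ciInf_le (Set.finite_range _).bddBelow iStar) (le_ciInf fun i => ?_)
  rw [integral_finsetSum _ fun t ht => integrable_loss hrun hℓ (Finset.mem_Icc.1 ht).1 _,
    integral_finsetSum _ fun t ht => integrable_loss hrun hℓ (Finset.mem_Icc.1 ht).1 _]
  refine Finset.sum_le_sum fun t ht => ?_
  have ht1 := (Finset.mem_Icc.1 ht).1
  have h := integral_loss_sub hrun hD ht1 i iStar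
  rw [integral_sub (integrable_loss hrun hℓ ht1 _) (integrable_loss hrun hℓ ht1 _),
    ← gap_eq hrun hℓ (hb 1 le_rfl) hD hgap i] at h
  have := mul_nonneg (hb t ht1).le (gap_nonneg D i)
  linarith

/-- In the stochastically constrained regime the regret is the expected sum of the gaps. -/
theorem pseudoRegret_eq_gap (hrun : IsRun μ η ℓ J) (hη_pos : ∀ t, 1 ≤ t → 0 < η t)
    (hℓ : ∀ t, 1 ≤ t → ∀ ω i, ℓ t ω i ∈ Set.Icc 0 (b t))
    {D : Fin K → Fin K → ℝ} (hb : ∀ t, 1 ≤ t → 0 < b t) (hD : IsStochConstrained μ b D ℓ J)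
    {iStar : Fin K} (hgap : gap D iStar = 0) (T : ℕ) :
    pseudoRegret μ ℓ J T = ∑ t ∈ Finset.Icc 1 T, ∫ ω, ∑ i ∈ Finset.univ.erase iStar,
      gap D i * b t * randProb η ℓ J t ω i ∂μ := by
  rw [pseudoRegret_eq_best hrun hℓ hb hD hgap,
    integral_finsetSum _ fun t ht => (integral_loss_arm hrun hη_pos hℓ (Finset.mem_Icc.1 ht).1).1,
    integral_finsetSum _ fun t ht => integrable_loss hrun hℓ (Finset.mem_Icc.1 ht).1 _,
    ← Finset.sum_sub_distrib]
  refine Finset.sum_congr rfl fun t ht => ?_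
  have ht1 := (Finset.mem_Icc.1 ht).1
  obtain ⟨-, h1, h2⟩ := integral_loss_arm hrun hη_pos hℓ ht1
  have hl := fun i => integrable_loss (μ := μ) hrun hℓ ht1 i
  have hdiff : ∀ i, Integrable (fun ω => ℓ t ω i - ℓ t ω iStar) μ := fun i => (hl i).sub (hl iStar)
  have hprod : ∀ i, Integrable (fun ω => randProb η ℓ J t ω i * (ℓ t ω i - ℓ t ω iStar)) μ :=
    fun i => (hdiff i).bdd_mul (c := 1) (integrable_randProb hrun hη_pos ht1 i).aestronglyMeasurable
      (Filter.Eventually.of_forall fun ω => abs_randProb_le_one η t ω i)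
  rw [h2, ← integral_sub h1 (hl iStar)]
  have e : ∀ ω, ∑ i, randProb η ℓ J t ω i * ℓ t ω i - ℓ t ω iStar
      = ∑ i ∈ Finset.univ.erase iStar, randProb η ℓ J t ω i * (ℓ t ω i - ℓ t ω iStar) := by
    intro ω
    have h3 : ∑ i, randProb η ℓ J t ω i * (ℓ t ω i - ℓ t ω iStar)
        = ∑ i, randProb η ℓ J t ω i * ℓ t ω i - ℓ t ω iStar := by
      simp only [mul_sub]
      rw [Finset.sum_sub_distrib, ← Finset.sum_mul, (randProb_mem η t ω).2, one_mul]
    rw [← h3, ← Finset.add_sum_erase _ _ (Finset.mem_univ iStar), sub_self, mul_zero, zero_add]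
  simp only [e]
  rw [integral_finsetSum _ fun i _ => hprod i, integral_finsetSum _ fun i _ =>
    (integrable_randProb hrun hη_pos ht1 i).const_mul _]
  refine Finset.sum_congr rfl fun i _ => ?_
  rw [integral_mul_of_condExp_ae_eq (f := fun ω => randProb η ℓ J t ω i) (past_le hrun t)
    ((measurable_pi_apply i).comp (measurable_randProb hη_pos ht1))
    (fun ω => abs_randProb_le_one η t ω i) (hdiff i) (hD t ht1 i iStar),
    gap_eq hrun hℓ (hb 1 le_rfl) hD hgap i]
  refine integral_congr_ae (Filter.Eventually.of_forall fun ω => ?_)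
  ring

theorem two_mul_sub_le_sq_div {A g x : ℝ} (hg : 0 < g) :
    2 * (A * x) - g * x ^ 2 ≤ (2 * A) ^ 2 / (4 * g) := by
  rw [le_div_iff₀ (by positivity)]
  nlinarith [sq_nonneg (2 * A - 2 * (g * x))]

theorem pseudoRegret_le_stochConstrained (hrun : IsRun μ η ℓ J) (hη_pos : ∀ t, 1 ≤ t → 0 < η t)
    (hη_anti : ∀ s t, 1 ≤ s → s ≤ t → η t ≤ η s)
    (hℓ : ∀ t, 1 ≤ t → ∀ ω i, ℓ t ω i ∈ Set.Icc 0 (b t)) {T : ℕ} (hT : 1 ≤ T)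
    {D : Fin K → Fin K → ℝ} {iStar : Fin K} {T₀ : ℕ} (hb : ∀ t, 1 ≤ t → 0 < b t)
    (hD : IsStochConstrained μ b D ℓ J) (hgap : ∀ i, gap D i = 0 ↔ i = iStar)
    (hT₀ : ∀ t, T₀ < t → t ≤ T → η t * b t ≤ 1 / 4) :
    pseudoRegret μ ℓ J T
      ≤ ∑ t ∈ Finset.Icc 1 T, ∑ i ∈ Finset.univ.erase iStar,
          (7 / 2 * η t * b t ^ 2 + 2 * stepConst η b t * invRateStep η t) ^ 2
            / (4 * gap D i * b t)
        + ∑ t ∈ Finset.Icc 1 T₀, η t * b t ^ 2 := by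
  have h0 : gap D iStar = 0 := (hgap iStar).2 rfl
  have hle := regret_le_sum_sqrt hrun hη_pos hη_anti hℓ hT iStar hT₀
  rw [← pseudoRegret_eq_best hrun hℓ hb hD h0] at hle
  have heq := pseudoRegret_eq_gap hrun hη_pos hℓ hb hD h0 T
  set F : ℕ → Ω → ℝ := fun t ω => ∑ k ∈ Finset.univ.erase iStar,
    (7 / 4 * η t * b t ^ 2 + stepConst η b t * invRateStep η t) * √(randProb η ℓ J t ω k)
      + if t ≤ T₀ then η t / 2 * b t ^ 2 else 0
  set Q : ℕ → Ω → ℝ := fun t ω => ∑ i ∈ Finset.univ.erase iStar,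
    gap D i * b t * randProb η ℓ J t ω i
  have hF : ∀ t, 1 ≤ t → Integrable (F t) μ := fun t ht =>
    (integrable_finsetSum _ fun k _ =>
      (integrable_sqrt_randProb hrun hη_pos ht k).const_mul _).add (integrable_const _)
  have hQ : ∀ t, 1 ≤ t → Integrable (Q t) μ := fun t ht =>
    integrable_finsetSum _ fun k _ => (integrable_randProb hrun hη_pos ht k).const_mul _
  have hround : ∀ t ∈ Finset.Icc 1 T, 2 * ∫ ω, F t ω ∂μ - ∫ ω, Q t ω ∂μ
      ≤ ∑ i ∈ Finset.univ.erase iStar,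
          (7 / 2 * η t * b t ^ 2 + 2 * stepConst η b t * invRateStep η t) ^ 2
            / (4 * gap D i * b t) + if t ≤ T₀ then η t * b t ^ 2 else 0 := by
    intro t ht
    have ht1 := (Finset.mem_Icc.1 ht).1
    rw [← integral_const_mul, ← integral_sub ((hF t ht1).const_mul 2) (hQ t ht1)]
    refine (integral_mono (((hF t ht1).const_mul 2).sub (hQ t ht1)) (integrable_const _)
      fun ω => ?_).trans (by rw [integral_const, probReal_univ, one_smul])
    have hsum : 2 * ∑ k ∈ Finset.univ.erase iStar,
          (7 / 4 * η t * b t ^ 2 + stepConst η b t * invRateStep η t) * √(randProb η ℓ J t ω k)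
        - ∑ i ∈ Finset.univ.erase iStar, gap D i * b t * randProb η ℓ J t ω i
        ≤ ∑ i ∈ Finset.univ.erase iStar,
          (7 / 2 * η t * b t ^ 2 + 2 * stepConst η b t * invRateStep η t) ^ 2
            / (4 * gap D i * b t) := by
      rw [Finset.mul_sum, ← Finset.sum_sub_distrib]
      refine Finset.sum_le_sum fun i hi => ?_
      have hg : 0 < gap D i := lt_of_le_of_ne (gap_nonneg D i) fun h =>
        Finset.ne_of_mem_erase hi ((hgap i).1 h.symm)
      have h := two_mul_sub_le_sq_div (mul_pos hg (hb t ht1))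
        (A := 7 / 4 * η t * b t ^ 2 + stepConst η b t * invRateStep η t)
        (x := √(randProb η ℓ J t ω i))
      rw [Real.sq_sqrt ((randProb_mem η t ω).1 i)] at h
      refine h.trans (le_of_eq ?_)
      congr 1 <;> ring
    have hif : 2 * (if t ≤ T₀ then η t / 2 * b t ^ 2 else 0)
        = if t ≤ T₀ then η t * b t ^ 2 else 0 := by
      split_ifs <;> ring
    simp only [Pi.sub_apply, F, Q, mul_add]
    rw [hif]
    linarith
  -- Self-bounding: twice the upper bound minus the exact gap formula.
  have htot : pseudoRegret μ ℓ J T ≤ ∑ t ∈ Finset.Icc 1 T, (2 * ∫ ω, F t ω ∂μ - ∫ ω, Q t ω ∂μ) := by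
    rw [Finset.sum_sub_distrib, ← Finset.mul_sum]
    linarith
  refine htot.trans ((Finset.sum_le_sum hround).trans ?_)
  rw [Finset.sum_add_distrib]
  gcongr
  rw [← Finset.sum_filter]
  -- `T₀` may exceed `T`; the extra rounds only add nonnegative terms.
  refine Finset.sum_le_sum_of_subset_of_nonneg ?_ ?_
  · intro t ht
    rw [Finset.mem_filter, Finset.mem_Icc] at ht
    exact Finset.mem_Icc.2 ⟨ht.1.1, ht.2⟩
  · intro t ht _
    have := hη_pos t (Finset.mem_Icc.1 ht).1
    positivity

end Regret

end TsallisBandit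

theorem theorem2 {Ω : Type*} [MeasurableSpace Ω] (μ : Measure Ω) [IsProbabilityMeasure μ]
    (K : ℕ) [NeZero K] (η b : ℕ → ℝ)
    (hη_pos : ∀ t, 1 ≤ t → 0 < η t)
    (hη_anti : ∀ s t, 1 ≤ s → s ≤ t → η t ≤ η s)
    (ℓ : ℕ → Ω → Fin K → ℝ) (J : ℕ → Ω → Fin K)
    (hrun : TsallisBandit.IsRun μ η ℓ J)
    (hℓ : ∀ t, 1 ≤ t → ∀ ω i, ℓ t ω i ∈ Set.Icc 0 (b t))
    (T : ℕ) (hT : 1 ≤ T) :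
    TsallisBandit.pseudoRegret μ ℓ J T
        ≤ √(K : ℝ) * (∑ t ∈ Finset.Icc 1 T, η t / 2 * b t ^ 2 + 4 / η T) + 1
    ∧ ∀ (D : Fin K → Fin K → ℝ) (iStar : Fin K) (T₀ : ℕ),
        (∀ t, 1 ≤ t → 0 < b t) →
        TsallisBandit.IsStochConstrained μ b D ℓ J →
        (∀ i, TsallisBandit.gap D i = 0 ↔ i = iStar) →
        (∀ t, T₀ < t → t ≤ T → η t * b t ≤ 1 / 4) →
        TsallisBandit.pseudoRegret μ ℓ J T
          ≤ ∑ t ∈ Finset.Icc 1 T, ∑ i ∈ Finset.univ.erase iStar,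
              (7 / 2 * η t * b t ^ 2
                + 2 * TsallisBandit.stepConst η b t * TsallisBandit.invRateStep η t) ^ 2
                / (4 * TsallisBandit.gap D i * b t)
            + ∑ t ∈ Finset.Icc 1 T₀, η t * b t ^ 2 + 2 := by
  refine ⟨?_, fun D iStar T₀ hb hD hgap hT₀ => ?_⟩
  · obtain ⟨i, hi⟩ := exists_eq_ciInf_of_finite
      (f := fun i => ∫ ω, ∑ t ∈ Finset.Icc 1 T, ℓ t ω i ∂μ)
    have h := TsallisBandit.regret_le_adversarial hrun hη_pos hη_anti hℓ hT i
    rw [TsallisBandit.pseudoRegret, ← hi]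
    -- The bound holds without the additive `1`; likewise the second part needs no additive `2`.
    linarith
  · have h := TsallisBandit.pseudoRegret_le_stochConstrained hrun hη_pos hη_anti hℓ hT hb hD hgap hT₀
    linarith
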